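/- Let $n\ge 2$, $\kappa\ge 1$ be integers and $\alpha\in(0,n/\kappa)$. **The field.** Let $\xi(x)$, $x\in\mathbb R^n$, be a measurable, mean-square continuous, zero-mean, homogeneous isotropic real Gaussian random field with $\mathbb E\,\xi(x)\xi(y)=B(\|x-y\|)$, $B(0)=1$ and $B(t)=t^{-\alpha}L_0(t)$ for $t>0$, where $L_0:(0,\infty)\to(0,\infty)$ is measurable and slowly varying at infinity. Assume that $\xi$ has the isotropic spectral density $\varphi(t)=c_1(n,\alpha)\,t^{\alpha-n}L(1/t)$, $t>0$, with $c_1(n,\alpha)=\Gamma(\frac{n-\alpha}{2})/(2^{\alpha}\pi^{n/2}\Gamma(\frac{\alpha}{2}))$, where $\alpha<n$ and $L:(0,\infty)\to(0,\infty)$ is measurable, locally bounded, slowly varying at infinity and $L(t)/L_0(t)\to1$ as $t\to\infty$; that is, $u^{n-1}\varphi(u)\in L_1(0,\infty)$ and, with $J_\nu$ the Bessel function of the first kind, for $t>0$ $$B(t)=\Big(\frac2t\Big)^{\frac{n-2}2}\Gamma\Big(\frac n2\Big)\int_0^\infty J_{\frac{n-2}2}(tu)\,u^{\frac{2-n}2}\,\frac{2\pi^{n/2}}{\Gamma(n/2)}u^{n-1}\varphi(u)\,du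 .$$ Let $H_\kappa(x)=(-1)^\kappa e^{x^2/2}\frac{d^\kappa}{dx^\kappa}e^{-x^2/2}$. **The window.** Let $\Delta_1=[a,b]$ and, for $1\le k<n$, $\Delta_{k+1}=\{(x,y)\in\mathbb R^{k}\times\mathbb R:\ x\in\Delta_k,\ f_l(x)\le y\le f_u(x)\}$ with functions $f_l=f_{l,k}\le f_u=f_{u,k}$ on $\Delta_k$, $f_l<f_u$ on the interior of $\Delta_k$, each of which is $C^1$ on $\Delta_k$ except on finitely many sections by coordinate hyperplanes $\{x_m=c\}$, where it has finite one-sided limits (finite jumps). Assume that $\Delta_n$ is compact and Jordan measurable and that $0$ is an interior point of $\Delta_n$. For $r>0$ put $\Delta_k(r)=r\Delta_k$ and $f_{q,r}(x)=rf_q(x/r)$, $q\in\{l,u\}$. Define finite sets $Q_k=Q_k(\Delta_k(r))\subset\mathbb Z^k$ by $Q_1=\{\lfloor ar\rfloor,\dots,\lceil br\rceil\}$ and, for $1\le k<n$, $$Q_{k+1}=\Big\{(i,j):\ i\in Q_k,\ P_k(r,i)\ne\emptyset,\ \Big\lfloor\inf_{P_k(r,i)}f_{l,r}\Big\rfloor\le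 j\le \Big[\sup_{P_k(r,i)}f_{u,r}\Big]\Big\},$$ where $P_k(r,i)=\big([i_1,i_1+1)\times[i_2,i_2+1]\times\dots\times[i_k,i_k+1]\big)\cap\Delta_k(r)$ and $[\cdot]$ stands for $\lceil\cdot\rceil$ if $k=1$ and for $\lfloor\cdot\rfloor$ if $k\ge2$. **The weight.** Let $\mathbf 1_n=(1,\dots,1)$ and let $g:\mathbb R^n\to\mathbb R$ be a measurable function such that $r^{2n-\alpha\kappa}g^2(r\mathbf 1_n)L^\kappa(r)\to\infty$ as $r\to\infty$ and such that, for some $\varepsilon>0$ and some function $g^*$, with $\Delta_{n\varepsilon}=(1+\varepsilon)\Delta_n$, $$\frac{g(ru)}{g(r\mathbf 1_n)}\to g^*(u)\ \ (r\to\infty)\ \text{ uniformly for } u\in\Delta_{n\varepsilon},\qquad \int_{\Delta_{n\varepsilon}}\int_{\Delta_{n\varepsilon}}\frac{|g^*(u)g^*(v)|}{\|u-v\|^{\kappa\alpha}}\,du\,dv<\infty .$$ Assume further that $g^*$ is bounded on $\Delta_{n\varepsilon}$ and continuous at almost every point of $\Delta_{n\varepsilon}$ (as a function on $\Delta_{n\varepsilon}$),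 and that either $\Delta_n$ is contained in the interior of $\Delta_{n\varepsilon}$, or $g^*(c\mathbf 1_n)\ne0$ for some $c\in(0,1)$ with $c\mathbf 1_n\in\Delta_{n\varepsilon}$. **Conclusion.** For every $r>0$ the integral below exists almost surely, the difference in the brackets has a finite second moment, and $$\lim_{r\to\infty}\frac{\mathbb E\Big[\int_{\Delta_n(r)}g(x)H_\kappa(\xi(x))\,dx-\sum_{i\in Q_n(\Delta_n(r))}g(i)H_\kappa(\xi(i))\Big]^2}{r^{2n-\alpha\kappa}L^\kappa(r)\,g^2(r\mathbf 1_n)}=0 .$$ -/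

import Mathlib

open MeasureTheory ProbabilityTheory Filter Topology Set
open scoped Pointwise ENNReal

noncomputable section

/-! ### Slowly varying functions and the isotropic spectral density -/

/-- A measurable function `L : (0,∞) → (0,∞)` that is slowly varying at infinity. (Values of the
Lean function at arguments `≤ 0` are irrelevant.) -/
structure SlowlyVarying (L : ℝ → ℝ) : Prop where
  measurable : Measurable ((Ioi (0 : ℝ)).domRestrict L)
  pos : ∀ t, 0 < t → 0 < L t
  tendsto : ∀ t, 0 < t → Tendsto (fun r : ℝ => L (t * r) / L r) atTop (𝓝 1)

/-- `L` is bounded on every compact subset of `(0,∞)`. -/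
def LocallyBoundedOnPos (L : ℝ → ℝ) : Prop :=
  ∀ K : Set ℝ, IsCompact K → K ⊆ Ioi 0 → ∃ C : ℝ, ∀ t ∈ K, |L t| ≤ C

/-- The Bessel function of the first kind `J_ν(z)`, for `ν > -1/2` and `z > 0`. -/
def besselFirst (ν z : ℝ) : ℝ :=
  ∑' m : ℕ, (-1 : ℝ) ^ m / ((m.factorial : ℝ) * Real.Gamma (m + ν + 1)) *
    (z / 2) ^ (2 * (m : ℝ) + ν)

/-- `φ` is the isotropic spectral density, in dimension `n`, of the isotropic covariance
function `B`: `u ^ (n-1) φ(u)` is integrable on `(0,∞)`, and `B` is the Hankel-type transform of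
the isotropic spectral measure `dΦ(u) = 2 π^(n/2) / Γ(n/2) u^(n-1) φ(u) du`. -/
def HasIsotropicSpectralDensity (n : ℕ) (B φ : ℝ → ℝ) : Prop :=
  IntegrableOn (fun u : ℝ => u ^ (n - 1) * φ u) (Ioi 0) ∧
  ∀ r : ℝ, 0 < r →
    B r = (2 / r) ^ (((n : ℝ) - 2) / 2) * Real.Gamma ((n : ℝ) / 2) *
      ∫ u in Ioi (0 : ℝ), besselFirst (((n : ℝ) - 2) / 2) (r * u) * u ^ ((2 - (n : ℝ)) / 2) *
        (2 * Real.pi ^ ((n : ℝ) / 2) / Real.Gamma ((n : ℝ) / 2) * (u ^ (n - 1) * φ u))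

/-- The constant `c₁(n, α) = Γ((n - α)/2) / (2^α π^(n/2) Γ(α/2))`. -/
def c₁ (n : ℕ) (α : ℝ) : ℝ :=
  Real.Gamma (((n : ℝ) - α) / 2) /
    ((2 : ℝ) ^ α * Real.pi ^ ((n : ℝ) / 2) * Real.Gamma (α / 2))

/-! ### The random field -/

/-- `ξ` is a (jointly) measurable, mean-square continuous, zero-mean, homogeneous isotropic
real Gaussian random field on `ℝⁿ` with covariance `E ξ(x) ξ(y) = B(‖x - y‖)`. -/
structure IsHomogeneousIsotropicGaussianField {n : ℕ} {Ω : Type*} [MeasurableSpace Ω]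
    (P : Measure Ω) (ξ : EuclideanSpace ℝ (Fin n) → Ω → ℝ) (B : ℝ → ℝ) : Prop where
  measurable : Measurable (Function.uncurry ξ)
  gaussian : IsGaussianProcess ξ P
  mean_zero : ∀ x, ∫ ω, ξ x ω ∂P = 0
  cov : ∀ x y, ∫ ω, ξ x ω * ξ y ω ∂P = B ‖x - y‖
  meanSquare_continuous :
    ∀ x, Tendsto (fun y => ∫ ω, (ξ y ω - ξ x ω) ^ 2 ∂P) (𝓝 x) (𝓝 0)

/-- Covariance assumption: `B(0) = 1` and `B(t) = t^(-α) L₀(t)` for `t > 0`, with `α > 0` and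
`L₀` slowly varying at infinity. -/
structure CovarianceAssumption (B : ℝ → ℝ) (α : ℝ) (L₀ : ℝ → ℝ) : Prop where
  alpha_pos : 0 < α
  slowlyVarying : SlowlyVarying L₀
  at_zero : B 0 = 1
  eq_of_pos : ∀ t, 0 < t → B t = t ^ (-α) * L₀ t

/-- Spectral assumption: `B` has the isotropic spectral density
`φ(t) = c₁(n,α) t^(α-n) L(1/t)`, where `0 < α < n` and `L ∼ L₀` is locally bounded and slowly
varying at infinity. -/
structure SpectralAssumption (n : ℕ) (B : ℝ → ℝ) (α : ℝ) (L₀ L : ℝ → ℝ) : Prop where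
  alpha_pos : 0 < α
  alpha_lt : α < n
  slowlyVarying : SlowlyVarying L
  locallyBounded : LocallyBoundedOnPos L
  equiv : Tendsto (fun t => L t / L₀ t) atTop (𝓝 1)
  spectral : HasIsotropicSpectralDensity n B (fun t => c₁ n α * t ^ (α - (n : ℝ)) * L (1 / t))

/-- The probabilists' Hermite polynomial `H_κ` as a function. -/
def hermiteFun (κ : ℕ) (t : ℝ) : ℝ := Polynomial.aeval t (Polynomial.hermite κ)

/-! ### The observation window

The window is built from lower and upper functions `lo k, up k : ℝᵏ → ℝ`, `k = 0, …, n - 1`.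
For `k = 0` these are two constants, the end points `a, b` of the interval `Δ₁ = [a, b]`. -/

/-- The sets `Δ_k`: `Δ₀` is the one-point space `ℝ⁰`, and `Δ_{k+1}` consists of the points over
`Δ_k` between the graphs of `lo k` and `up k`. -/
def region (lo up : (k : ℕ) → (Fin k → ℝ) → ℝ) : (k : ℕ) → Set (Fin k → ℝ)
  | 0 => univ
  | k + 1 => {x | (fun j : Fin k => x j.castSucc) ∈ region lo up k ∧
      lo k (fun j : Fin k => x j.castSucc) ≤ x (Fin.last k) ∧
      x (Fin.last k) ≤ up k (fun j : Fin k => x j.castSucc)}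

/-- `Δ_n` as a subset of the Euclidean space `ℝⁿ`. -/
def window (lo up : (k : ℕ) → (Fin k → ℝ) → ℝ) (n : ℕ) : Set (EuclideanSpace ℝ (Fin n)) :=
  {x | x.ofLp ∈ region lo up n}

/-- `f` is `C¹` on `D` except for finite jumps on finitely many coordinate hyperplanes
`x_m = c`, `c ∈ J m`. At a point `p` of such hyperplanes, `f` has a finite limit from each side,
a side being given by a choice, for each `m` with `p m ∈ J m`, of `x m < p m` or `p m < x m`. -/
def SmoothExceptJumps {k : ℕ} (D : Set (Fin k → ℝ)) (f : (Fin k → ℝ) → ℝ) : Prop :=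
  ∃ J : Fin k → Finset ℝ,
    ContDiffOn ℝ 1 f (D \ {x | ∃ m, x m ∈ J m}) ∧
    ∀ p ∈ D, (∃ m, p m ∈ J m) → ∀ above : Set (Fin k), ∃ l : ℝ,
      Tendsto f (𝓝[{x | x ∈ D ∧ ∀ m, p m ∈ J m →
        (m ∈ above → p m < x m) ∧ (m ∉ above → x m < p m)}] p) (𝓝 l)

/-- The standing assumptions on the window `Δ_n`: it is a compact Jordan-measurable set with the
origin in its interior, and the functions which describe it are `C¹` except for finite jumps on
coordinate hyperplanes, the lower one being below the upper one, strictly so in the interior. -/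
structure IsWindow (n : ℕ) (lo up : (k : ℕ) → (Fin k → ℝ) → ℝ) : Prop where
  compact : IsCompact (window lo up n)
  jordan : volume (frontier (window lo up n)) = 0
  zero_mem : (0 : EuclideanSpace ℝ (Fin n)) ∈ interior (window lo up n)
  le : ∀ k < n, ∀ x ∈ region lo up k, lo k x ≤ up k x
  lt : ∀ k < n, ∀ x ∈ interior (region lo up k), lo k x < up k x
  smooth_lo : ∀ k < n, SmoothExceptJumps (region lo up k) (lo k)
  smooth_up : ∀ k < n, SmoothExceptJumps (region lo up k) (up k)

/-! ### The lattice points of the window -/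

/-- The scaled function `f_r(x) = r f(x / r)`. -/
def scaled {k : ℕ} (r : ℝ) (f : (Fin k → ℝ) → ℝ) (x : Fin k → ℝ) : ℝ :=
  r * f (r⁻¹ • x)

/-- `P_k(r, i)`: the part of the unit cell `[i₁, i₁+1) × [i₂, i₂+1] × ⋯ × [i_k, i_k+1]` that
lies in `Δ_k(r) = r Δ_k`. -/
def cellPart (lo up : (k : ℕ) → (Fin k → ℝ) → ℝ) (r : ℝ) {k : ℕ} (i : Fin k → ℤ) :
    Set (Fin k → ℝ) :=
  {x | x ∈ r • region lo up k ∧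
    ∀ j : Fin k, (i j : ℝ) ≤ x j ∧ x j ≤ i j + 1 ∧ (j.val = 0 → x j < i j + 1)}

/-- `f_r^{(l)}(i)`: the floor of the infimum of the scaled lower function over `P_k(r, i)`. -/
def lowerIndex (lo up : (k : ℕ) → (Fin k → ℝ) → ℝ) (r : ℝ) {k : ℕ} (i : Fin k → ℤ) : ℤ :=
  ⌊sInf (scaled r (lo k) '' cellPart lo up r i)⌋

/-- `f_r^{(u)}(i)`: the rounded supremum of the scaled upper function over `P_k(r, i)`. It is
rounded up for the first two coordinates (`k = 0, 1`) and down for the others. -/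
def upperIndex (lo up : (k : ℕ) → (Fin k → ℝ) → ℝ) (r : ℝ) {k : ℕ} (i : Fin k → ℤ) : ℤ :=
  if k ≤ 1 then ⌈sSup (scaled r (up k) '' cellPart lo up r i)⌉
  else ⌊sSup (scaled r (up k) '' cellPart lo up r i)⌋

open Classical in
/-- The set `Q_k(Δ_k(r))` of lattice points. Over a point `i` of `Q_k` with empty `P_k(r, i)`
there is no point of `Q_{k+1}`. -/
def latticeSet (lo up : (k : ℕ) → (Fin k → ℝ) → ℝ) (r : ℝ) : (k : ℕ) → Finset (Fin k → ℤ)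
  | 0 => Finset.univ
  | k + 1 => (latticeSet lo up r k).biUnion fun i =>
      if (cellPart lo up r i).Nonempty then
        (Finset.Icc (lowerIndex lo up r i) (upperIndex lo up r i)).image
          fun m => Fin.snoc (α := fun _ => ℤ) i m
      else ∅

/-- The point of `ℝⁿ` with the integer coordinates `i`. -/
def latticePoint {n : ℕ} (i : Fin n → ℤ) : EuclideanSpace ℝ (Fin n) :=
  WithLp.toLp 2 fun j => (i j : ℝ)

/-! ### The weight function and the functionals -/

/-- The vector `1_n = (1, …, 1)`. -/
def oneVec (n : ℕ) : EuclideanSpace ℝ (Fin n) := WithLp.toLp 2 fun _ => (1 : ℝ)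

/-- Assumption on the weight function `g`, for a window `Δ`: with `Δ_ε = (1 + ε) Δ` and
`g*` the limit of `g(r u) / g(r 1_n)`, uniformly on `Δ_ε`. The fields `bounded` and
`ae_continuous` say that `g*` is Riemann integrable on `Δ_ε`. The last field excludes the
degenerate case in which `Δ_ε` is not a neighbourhood of `Δ` and the convergence on `Δ_ε` carries
no information about `g` near `Δ \ Δ_ε`. -/
structure WeightAssumption {n : ℕ} (Δ : Set (EuclideanSpace ℝ (Fin n))) (α : ℝ) (κ : ℕ)
    (L : ℝ → ℝ) (g gstar : EuclideanSpace ℝ (Fin n) → ℝ) (ε : ℝ) : Prop where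
  eps_pos : 0 < ε
  measurable : Measurable g
  diverges : Tendsto (fun r : ℝ => r ^ (2 * (n : ℝ) - α * κ) * g (r • oneVec n) ^ 2 * L r ^ κ)
    atTop atTop
  uniform : TendstoUniformlyOn (fun (r : ℝ) u => g (r • u) / g (r • oneVec n)) gstar atTop
    ((1 + ε) • Δ)
  integral_finite :
    ∫⁻ u in (1 + ε) • Δ, ∫⁻ v in (1 + ε) • Δ,
      ENNReal.ofReal (|gstar u * gstar v| / ‖u - v‖ ^ ((κ : ℝ) * α)) < ∞
  bounded : ∃ C : ℝ, ∀ u ∈ (1 + ε) • Δ, |gstar u| ≤ C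
  ae_continuous : ∀ᵐ u ∂(volume.restrict ((1 + ε) • Δ)),
    ContinuousWithinAt gstar ((1 + ε) • Δ) u
  nondegenerate : Δ ⊆ interior ((1 + ε) • Δ) ∨
    ∃ c : ℝ, 0 < c ∧ c < 1 ∧ c • oneVec n ∈ (1 + ε) • Δ ∧ gstar (c • oneVec n) ≠ 0

/-- The integral functional `∫_{Δ_n(r)} g(x) H_κ(ξ(x)) dx`. -/
def integralFunctional {n : ℕ} {Ω : Type*} (lo up : (k : ℕ) → (Fin k → ℝ) → ℝ) (κ : ℕ)
    (g : EuclideanSpace ℝ (Fin n) → ℝ) (ξ : EuclideanSpace ℝ (Fin n) → Ω → ℝ) (r : ℝ) (ω : Ω) :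
    ℝ :=
  ∫ x in r • window lo up n, g x * hermiteFun κ (ξ x ω)

/-- The additive functional `∑_{i ∈ Q_n(Δ_n(r))} g(i) H_κ(ξ(i))`. -/
def additiveFunctional {n : ℕ} {Ω : Type*} (lo up : (k : ℕ) → (Fin k → ℝ) → ℝ) (κ : ℕ)
    (g : EuclideanSpace ℝ (Fin n) → ℝ) (ξ : EuclideanSpace ℝ (Fin n) → Ω → ℝ) (r : ℝ) (ω : Ω) :
    ℝ :=
  ∑ i ∈ latticeSet lo up r n, g (latticePoint i) * hermiteFun κ (ξ (latticePoint i) ω)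

end

noncomputable section

/-! The lattice sum is the integral of a step field that is constant on unit cells, so the
difference of the two functionals is the integral of one signed two-term field. Orthogonality of
Hermite polynomials turns its second moment into a double integral of four terms, each of the form
weight times weight times `κ! B(distance)^κ`. In these terms each of the two points is either kept
or replaced by its coordinatewise integer part (`secondMoment_diff`, `integral_diffField_mul`).

Rescale both points by `r` and divide by the normalisation. Rounding moves a point by a bounded
amount, hence by `O(1/r)` after rescaling, so slow variation gives all four terms the same almost
everywhere limit: `κ! G(u) G(v) ‖u - v‖^(-ακ)` on the square of the window and `0` elsewhere, where
`G` is the limit of the rescaled weight. The four signs add up to zero, so the signed integrand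
tends to zero and no limiting integral has to be evaluated.

Domination comes from Potter's bound, which replaces the slowly varying factor by a slightly larger
exponent `γ` with `ακ < γ < n`. Near the diagonal, where the sampled distance may be far smaller
than `r ‖u - v‖`, the bound `|B| ≤ 1` takes over (`CovarianceAssumption.exists_normalized_le_rpow`).
The kernel `‖u - v‖^(-γ)` is locally integrable.

Two facts about the window remain. The step weight must converge to the same limit as the continuous
one: points of the window have their integer parts in the lattice set
(`IsWindow.floor_mem_latticeSet`), and almost every point outside eventually has not
(`eventually_floor_notMem_latticeSet`). Moreover lattice points may lie outside the scaled window,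
so `g` must be controlled on a dilate that is a neighbourhood of the window
(`WeightAssumption.exists_dilate`) and that contains these points after rescaling
(`IsWindow.eventually_latticePoint_mem`). -/

/-! ### Hermite polynomials under the standard Gaussian law -/

open Polynomial in
theorem integrable_eval_gaussianReal (p : ℝ[X]) (m : ℝ) (v : NNReal) :
    Integrable (fun x => p.eval x) (gaussianReal m v) := by
  induction p using Polynomial.induction_on' with
  | add p q hp hq => exact (hp.add hq).congr (ae_of_all _ fun x => by simp)
  | monomial k a =>
    simp only [eval_monomial]
    refine Integrable.const_mul ?_ a
    have h := memLp_id_gaussianReal (μ := m) (v := v) (k : NNReal)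
    have h2 := h.integrable_norm_pow'
    have h3 : Integrable (fun x : ℝ => ‖x ^ k‖) (gaussianReal m v) := by simpa using h2
    exact (integrable_norm_iff (by fun_prop)).1 h3

open Polynomial in
/-- Gaussian integration by parts for polynomials. -/
theorem integral_mul_eval_gaussianReal (p : ℝ[X]) :
    ∫ x, x * p.eval x ∂(gaussianReal 0 1) = ∫ x, p.derivative.eval x ∂(gaussianReal 0 1) := by
  have hd : ∀ x : ℝ, HasDerivAt (gaussianPDFReal 0 1) (-x * gaussianPDFReal 0 1 x) x := by
    intro x
    rw [gaussianPDFReal_def]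
    have h : HasDerivAt (fun x : ℝ => -(x - 0) ^ 2 / (2 * ((1 : NNReal) : ℝ))) (-x) x := by
      have := (((hasDerivAt_id x).sub_const 0).pow 2).neg.div_const (2 * ((1 : NNReal) : ℝ))
      convert! this using 1
      simp only [id, NNReal.coe_one]
      push_cast
      ring
    convert! (h.exp.const_mul (√(2 * Real.pi * ((1 : NNReal) : ℝ)))⁻¹) using 1
    ring
  have hint : ∀ q : ℝ[X], Integrable (fun x => q.eval x * gaussianPDFReal 0 1 x) := by
    intro q
    have h := integrable_eval_gaussianReal q 0 1
    rw [gaussianReal_of_var_ne_zero _ one_ne_zero,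
      integrable_withDensity_iff_integrable_smul' (measurable_gaussianPDF _ _)
        (ae_of_all _ fun _ => gaussianPDF_lt_top)] at h
    simpa [mul_comm] using h
  have key := integral_mul_deriv_eq_deriv_mul_of_integrable
    (u := fun x => p.eval x) (v := gaussianPDFReal 0 1)
    (u' := fun x => p.derivative.eval x) (v' := fun x => -x * gaussianPDFReal 0 1 x)
    (fun x _ => p.hasDerivAt x) (fun x _ => hd x)
    (by
      have := (hint (X * p)).neg
      refine this.congr (ae_of_all _ fun x => ?_)
      simp; ring)
    (hint p.derivative) (hint p)
  rw [integral_gaussianReal_eq_integral_smul one_ne_zero,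
    integral_gaussianReal_eq_integral_smul one_ne_zero]
  simp only [smul_eq_mul]
  have e1 : ∫ x, gaussianPDFReal 0 1 x * (x * p.eval x)
      = - ∫ x, p.eval x * (-x * gaussianPDFReal 0 1 x) := by
    rw [← integral_neg]; congr 1; ext x; ring
  rw [e1, key, neg_neg]
  congr 1; ext x; ring

-- Since `H_{k+1} = x H_k - H_k'`, one Gaussian integration by parts applied to `H_k p` trades one
-- Hermite degree for one derivative on `p`.
open Polynomial in
theorem integral_hermite_mul_eval (k : ℕ) (p : ℝ[X]) :
    ∫ x, hermiteFun k x * p.eval x ∂(gaussianReal 0 1)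
      = ∫ x, (derivative^[k] p).eval x ∂(gaussianReal 0 1) := by
  induction k generalizing p with
  | zero => simp [hermiteFun]
  | succ k ih =>
    rw [Function.iterate_succ_apply, ← ih]
    set h : ℝ[X] := (hermite k).map (Int.castRingHom ℝ) with hh
    have hk : ∀ x, hermiteFun k x = h.eval x := fun x => by
      simp [hermiteFun, hh, aeval_def, eval₂_eq_eval_map]
    have hk1 : ∀ x, hermiteFun (k + 1) x = x * h.eval x - h.derivative.eval x := fun x => by
      simp [hermiteFun, hermite_succ, hh, aeval_def, eval₂_eq_eval_map, derivative_map]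
    have := integral_mul_eval_gaussianReal (h * p)
    have e : ∀ x, hermiteFun (k + 1) x * p.eval x
        = x * (h * p).eval x - (h.derivative * p).eval x := fun x => by
      rw [hk1]; simp; ring
    simp_rw [e, hk]
    have i1 : Integrable (fun x => x * (h * p).eval x) (gaussianReal 0 1) := by
      exact (integrable_eval_gaussianReal (X * (h * p)) 0 1).congr (ae_of_all _ fun x => by simp)
    rw [integral_sub i1 (integrable_eval_gaussianReal _ 0 1), this,
      ← integral_sub (integrable_eval_gaussianReal _ 0 1) (integrable_eval_gaussianReal _ 0 1)]
    congr 1; ext x; simp [derivative_mul]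

-- After moving all `k` derivatives onto the second factor, a monic polynomial of degree `k`
-- composed with `ρ x + w` has become the constant `ρ^k k!`. That `w` disappears is what makes the
-- orthogonality relation below independent of the law of the residual variable.
open Polynomial in
theorem integral_hermite_mul_hermite_affine (k : ℕ) (ρ w : ℝ) :
    ∫ x, hermiteFun k x * hermiteFun k (ρ * x + w) ∂(gaussianReal 0 1)
      = ρ ^ k * k.factorial := by
  set h : ℝ[X] := (hermite k).map (Int.castRingHom ℝ) with hh
  have hm : h.Monic := (hermite_monic k).map _
  have hdeg : h.natDegree = k := by
    rw [hh, (hermite_monic k).natDegree_map, natDegree_hermite]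
  have hk : ∀ x, hermiteFun k x = h.eval x := fun x => by
    simp [hermiteFun, hh, aeval_def, eval₂_eq_eval_map]
  set q : ℝ[X] := h.comp (C ρ * X + C w) with hq
  have e : ∀ x, hermiteFun k (ρ * x + w) = q.eval x := fun x => by
    rw [hk]; simp [hq, eval_comp]
  simp_rw [e]
  rw [integral_hermite_mul_eval]
  have hd : ∀ j (f : ℝ[X]), derivative^[j] (f.comp (C ρ * X + C w))
      = C (ρ ^ j) * (derivative^[j] f).comp (C ρ * X + C w) := by
    intro j
    induction j with
    | zero => simp
    | succ j ih =>
      intro f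
      rw [Function.iterate_succ_apply, Function.iterate_succ_apply, derivative_comp]
      simp only [derivative_add, derivative_mul, derivative_C, derivative_X]
      rw [zero_mul, zero_add, mul_one, add_zero, iterate_derivative_C_mul, ih]
      rw [← mul_assoc, ← C_mul, pow_succ']
  have hkd : derivative^[k] h = C (k.factorial : ℝ) := by
    have h0 : (derivative^[k] h).natDegree = 0 := by
      have := natDegree_iterate_derivative h k
      omega
    rw [eq_C_of_natDegree_eq_zero h0, coeff_iterate_derivative]
    have : h.coeff k = 1 := by rw [← hdeg]; exact hm
    simp [this, Nat.descFactorial_self]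
  rw [hq, hd, hkd]
  simp

theorem hermiteFun_eq_eval (k : ℕ) (x : ℝ) :
    hermiteFun k x = ((Polynomial.hermite k).map (Int.castRingHom ℝ)).eval x := by
  simp [hermiteFun, Polynomial.aeval_def, Polynomial.eval₂_eq_eval_map]

theorem continuous_hermiteFun (k : ℕ) : Continuous (hermiteFun k) := by
  simp_rw [funext (hermiteFun_eq_eval k)]
  exact Polynomial.continuous _

/-! ### Orthogonality for jointly Gaussian variables -/

section Pair

variable {Ω : Type*} [MeasurableSpace Ω] {P : Measure Ω} {X Y : Ω → ℝ}

theorem hasLaw_standard (hX : HasGaussianLaw X P) (h0 : ∫ ω, X ω ∂P = 0)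
    (h1 : ∫ ω, X ω * X ω ∂P = 1) : P.map X = gaussianReal 0 1 := by
  have h := hX.map_eq_gaussianReal
  have hv : Var[X; P] = 1 := by
    rw [variance_of_integral_eq_zero hX.aemeasurable h0]
    simpa [sq] using h1
  rw [h, h0, hv]; simp

theorem memLp_hermiteFun_comp (k : ℕ) (hX : HasGaussianLaw X P) (h0 : ∫ ω, X ω ∂P = 0)
    (h1 : ∫ ω, X ω * X ω ∂P = 1) : MemLp (fun ω => hermiteFun k (X ω)) 2 P := by
  have hm : AEMeasurable X P := hX.aemeasurable
  have hc := continuous_hermiteFun k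
  rw [memLp_two_iff_integrable_sq (hc.comp_aestronglyMeasurable hm.aestronglyMeasurable)]
  have hi := integrable_eval_gaussianReal
    (((Polynomial.hermite k).map (Int.castRingHom ℝ)) ^ 2) 0 1
  rw [← hasLaw_standard hX h0 h1, integrable_map_measure (by fun_prop) hm] at hi
  refine hi.congr (ae_of_all _ fun ω => ?_)
  simp [hermiteFun_eq_eval]

/-- Orthogonality of the Hermite polynomials of jointly Gaussian standard variables. -/
theorem integral_hermiteFun_mul_hermiteFun [IsProbabilityMeasure P] (k : ℕ)
    (hXY : HasGaussianLaw (fun ω => (X ω, Y ω)) P)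
    (hX0 : ∫ ω, X ω ∂P = 0) (hY0 : ∫ ω, Y ω ∂P = 0) (hX1 : ∫ ω, X ω * X ω ∂P = 1)
    (hY1 : ∫ ω, Y ω * Y ω ∂P = 1) :
    ∫ ω, hermiteFun k (X ω) * hermiteFun k (Y ω) ∂P
      = (∫ ω, X ω * Y ω ∂P) ^ k * k.factorial := by
  set ρ := ∫ ω, X ω * Y ω ∂P with hρ
  have hX : HasGaussianLaw X P := hXY.fst
  have hY : HasGaussianLaw Y P := hXY.snd
  -- The regression residual is uncorrelated with `X`, hence independent of it by joint Gaussianity.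
  -- Integrating over `X` first then gives a constant.
  set W : Ω → ℝ := fun ω => Y ω - ρ * X ω with hW
  have hXW : HasGaussianLaw (fun ω => (X ω, W ω)) P := by
    have := hXY.map_fun ((ContinuousLinearMap.fst ℝ ℝ ℝ).prod
      (ContinuousLinearMap.snd ℝ ℝ ℝ - ρ • ContinuousLinearMap.fst ℝ ℝ ℝ))
    simpa [hW] using this
  have hXm : MemLp X 2 P := hX.memLp_two
  have hYm : MemLp Y 2 P := hY.memLp_two
  have hWm : MemLp W 2 P := hYm.sub (hXm.const_mul ρ)
  have hcov : cov[X, W; P] = 0 := by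
    rw [covariance_eq_sub hXm hWm, hX0, zero_mul, sub_zero]
    have e : ∀ ω, (X * W) ω = X ω * Y ω - ρ * (X ω * X ω) := fun ω => by
      simp [hW]; ring
    simp_rw [e]
    rw [integral_sub (f := fun ω => X ω * Y ω) (g := fun ω => ρ * (X ω * X ω))
      (hXm.integrable_mul hYm) ((hXm.integrable_mul hXm).const_mul ρ),
      integral_const_mul, hX1, ← hρ]
    ring
  have hind : IndepFun X W P := hXW.indepFun_of_covariance_eq_zero hcov
  have hXa := hX.aemeasurable
  have hWa : AEMeasurable W P := hWm.aemeasurable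
  have hmap := (indepFun_iff_map_prod_eq_prod_map_map hXa hWa).1 hind
  have hc := continuous_hermiteFun k
  set F : ℝ × ℝ → ℝ := fun z => hermiteFun k z.1 * hermiteFun k (ρ * z.1 + z.2) with hF
  have hFc : Continuous F := by fun_prop
  have e1 : ∀ ω, hermiteFun k (X ω) * hermiteFun k (Y ω) = F (X ω, W ω) := fun ω => by
    simp [hF, hW]
  have hint : Integrable F ((P.map X).prod (P.map W)) := by
    rw [← hmap, integrable_map_measure hFc.aestronglyMeasurable (hXa.prodMk hWa)]
    have := (memLp_hermiteFun_comp k hX hX0 hX1).integrable_mul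
      (memLp_hermiteFun_comp k hY hY0 hY1)
    refine this.congr (ae_of_all _ fun ω => ?_)
    exact e1 ω
  simp_rw [e1]
  rw [← integral_map (φ := fun ω => (X ω, W ω)) (f := F) (hXa.prodMk hWa)
    hFc.aestronglyMeasurable, hmap, integral_prod_symm _ hint, hasLaw_standard hX hX0 hX1]
  simp only [hF, integral_hermite_mul_hermite_affine]
  have : IsProbabilityMeasure (P.map W) := Measure.isProbabilityMeasure_map hWa
  simp

end Pair

/-! ### Slow variation: uniform convergence and Potter's bound -/

/-- The uniform convergence theorem for slowly varying functions, in additive notation. -/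
theorem exists_forall_abs_add_sub_le {l : ℝ → ℝ} (hm : Measurable l)
    (h : ∀ u, Tendsto (fun x => l (x + u) - l x) atTop (𝓝 0)) {ε : ℝ} (hε : 0 < ε) :
    ∃ x₀, ∀ x ≥ x₀, ∀ u ∈ Icc (0 : ℝ) 1, |l (x + u) - l x| ≤ ε := by
  -- Truncation makes the increments bounded, so pointwise convergence passes to integrals by
  -- dominated convergence, while a triangle inequality survives.
  set φ : ℝ → ℝ := fun t => min 1 |t| with hφ
  have hφ0 : ∀ t, 0 ≤ φ t := fun t => by positivity
  have hφ1 : ∀ t, φ t ≤ 1 := fun t => min_le_left _ _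
  have hφc : Continuous φ := by fun_prop
  have hφadd : ∀ a b, φ (a - b) ≤ φ a + φ b := by
    intro a b
    have h1 := abs_sub a b
    simp only [hφ]
    rcases min_cases 1 |a| with ha | ha <;> rcases min_cases 1 |b| with hb | hb <;>
      rw [ha.1, hb.1]
    · exact (min_le_left _ _).trans (by norm_num)
    · exact (min_le_left _ _).trans (by linarith [abs_nonneg b])
    · exact (min_le_left _ _).trans (by linarith [abs_nonneg a])
    · exact (min_le_right _ _).trans h1
  have hmeas : ∀ x, Measurable fun v => φ (l (x + v) - l x) := fun x =>
    hφc.measurable.comp ((hm.comp (measurable_const_add x)).sub_const _)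
  have hint : ∀ x (y : ℝ), ∀ a b : ℝ,
      IntervalIntegrable (fun v => φ (l (x + v) - l y)) volume a b := by
    intro x y a b
    refine (intervalIntegrable_const (c := (1 : ℝ))).mono_fun ?_ (ae_of_all _ fun v => ?_)
    · exact (hφc.measurable.comp
        ((hm.comp (measurable_const_add x)).sub_const _)).aestronglyMeasurable
    · simp only [Real.norm_eq_abs, abs_one, abs_of_nonneg (hφ0 _)]
      exact hφ1 _
  -- The interval has length two so that it contains `[u, u + 1]` for every `u` in `[0, 1]`.
  set Φ : ℝ → ℝ := fun x => ∫ v in (0 : ℝ)..2, φ (l (x + v) - l x) with hΦ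
  have hlim : Tendsto Φ atTop (𝓝 0) := by
    have := intervalIntegral.tendsto_integral_filter_of_dominated_convergence
      (μ := volume) (a := 0) (b := 2) (l := atTop)
      (F := fun x v => φ (l (x + v) - l x)) (f := fun _ => (0 : ℝ)) (fun _ => 1)
      (Eventually.of_forall fun x => (hmeas x).aestronglyMeasurable)
      (Eventually.of_forall fun x => ae_of_all _ fun v _ => by
        simp only [Real.norm_eq_abs, abs_of_nonneg (hφ0 _)]; exact hφ1 _)
      intervalIntegrable_const
      (ae_of_all _ fun v _ => by
        have h2 := (hφc.tendsto 0).comp (h v)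
        simpa [hφ, Function.comp_def] using h2)
    simpa using this
  -- Below `1/2` the truncation at `1` is inactive, so smallness of `φ` is smallness of the
  -- increment itself.
  set ε' := min ε (1 / 2) with hε'
  have hε'0 : 0 < ε' := by positivity
  obtain ⟨x₀, hx₀⟩ := eventually_atTop.1 (hlim.eventually (gt_mem_nhds (half_pos hε'0)))
  refine ⟨x₀, fun x hx u hu => ?_⟩
  have hΦle : ∀ y a, 0 ≤ a → a ≤ 1 → ∫ v in a..a + 1, φ (l (y + v) - l y) ≤ Φ y := by
    intro y a ha0 ha1
    exact intervalIntegral.integral_mono_interval ha0 (by linarith) (by linarith)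
      (ae_of_all _ fun v => hφ0 _) (hint y y 0 2)
  -- Compare both values with `l (x + u + w)` and average over `w` in `[0, 1]`. The resulting bound
  -- is uniform in `u`.
  have key : φ (l (x + u) - l x) ≤ Φ x + Φ (x + u) := by
    have e1 : ∫ w in (0 : ℝ)..1, φ (l (x + u) - l x) = φ (l (x + u) - l x) := by simp
    have e2 : ∫ w in (0 : ℝ)..1, φ (l (x + (u + w)) - l x)
        = ∫ v in u..u + 1, φ (l (x + v) - l x) := by
      rw [intervalIntegral.integral_comp_add_left (fun v => φ (l (x + v) - l x)) u]
      simp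
    have i2 : IntervalIntegrable (fun w => φ (l (x + (u + w)) - l x)) volume 0 1 := by
      simpa only [add_assoc] using hint (x + u) x 0 1
    have i3 := hint (x + u) (x + u) 0 1
    calc φ (l (x + u) - l x) = ∫ w in (0 : ℝ)..1, φ (l (x + u) - l x) := e1.symm
      _ ≤ ∫ w in (0 : ℝ)..1,
          (φ (l (x + (u + w)) - l x) + φ (l (x + u + w) - l (x + u))) := by
        refine intervalIntegral.integral_mono_on (by norm_num) intervalIntegrable_const
          (i2.add i3) fun w _ => ?_
        have := hφadd (l (x + (u + w)) - l x) (l (x + u + w) - l (x + u))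
        rw [← add_assoc] at this ⊢
        convert! this using 2; ring
      _ = (∫ w in (0 : ℝ)..1, φ (l (x + (u + w)) - l x))
          + ∫ w in (0 : ℝ)..1, φ (l (x + u + w) - l (x + u)) :=
        intervalIntegral.integral_add i2 i3
      _ ≤ Φ x + Φ (x + u) := by
        rw [e2]
        have := hΦle (x + u) 0 le_rfl zero_le_one
        rw [zero_add] at this
        exact add_le_add (hΦle x u hu.1 hu.2) this
  have h1 := hx₀ x hx
  have h2 := hx₀ (x + u) (by linarith [hu.1])
  have h3 : φ (l (x + u) - l x) < ε' := by linarith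
  have h4 : ε' ≤ 1 / 2 := min_le_right _ _
  have h5 : ε' ≤ ε := min_le_left _ _
  simp only [hφ] at h3
  rcases min_lt_iff.1 h3 with h6 | h6 <;> linarith

/-- Potter's bound, in additive notation. -/
theorem exists_forall_abs_sub_le {l : ℝ → ℝ} (hm : Measurable l)
    (h : ∀ u, Tendsto (fun x => l (x + u) - l x) atTop (𝓝 0)) {δ : ℝ} (hδ : 0 < δ) :
    ∃ x₀, ∀ x ≥ x₀, ∀ y ≥ x₀, |l y - l x| ≤ δ * (|y - x| + 1) := by
  obtain ⟨x₀, hx₀⟩ := exists_forall_abs_add_sub_le hm h hδ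
  -- Chain unit steps, each costing `δ`; this is where the linear growth in `|y - x|` comes from.
  have step : ∀ k : ℕ, ∀ x ≥ x₀, ∀ u ∈ Icc (0 : ℝ) 1, |l (x + (k + u)) - l x| ≤ δ * (k + 1) := by
    intro k
    induction k with
    | zero => intro x hx u hu; simpa using hx₀ x hx u hu
    | succ k ih =>
      intro x hx u hu
      have h1 := hx₀ x hx 1 ⟨zero_le_one, le_rfl⟩
      have h2 := ih (x + 1) (by linarith) u hu
      have e : x + 1 + (k + u) = x + (((k + 1 : ℕ) : ℝ) + u) := by push_cast; ring
      rw [e] at h2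
      push_cast at h2 ⊢
      calc _ ≤ |l (x + (k + 1 + u)) - l (x + 1)| + |l (x + 1) - l x| := abs_sub_le _ _ _
        _ ≤ δ * (k + 1) + δ := add_le_add h2 h1
        _ = _ := by ring
  have aux : ∀ x ≥ x₀, ∀ y, x ≤ y → |l y - l x| ≤ δ * (|y - x| + 1) := by
    intro x hx y hxy
    have h0 : 0 ≤ y - x := by linarith
    have h1 := Nat.floor_le h0
    have h2 := Nat.lt_floor_add_one (y - x)
    have h3 := step ⌊y - x⌋₊ x hx (y - x - ⌊y - x⌋₊) ⟨by linarith, by linarith⟩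
    rw [show x + (⌊y - x⌋₊ + (y - x - ⌊y - x⌋₊)) = y by ring] at h3
    rw [abs_of_nonneg h0]
    exact h3.trans (mul_le_mul_of_nonneg_left (by linarith) hδ.le)
  refine ⟨x₀, fun x hx y hy => ?_⟩
  rcases le_total x y with hxy | hxy
  · exact aux x hx y hxy
  · rw [abs_sub_comm, abs_sub_comm y x]; exact aux y hy x hxy

namespace SlowlyVarying

variable {L : ℝ → ℝ}

theorem measurable_log_exp (hL : SlowlyVarying L) : Measurable fun x => Real.log (L (Real.exp x)) :=
  Real.measurable_log.comp
    (hL.measurable.comp (Real.measurable_exp.subtype_mk (h := fun x => Real.exp_pos x)))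

theorem tendsto_log_exp (hL : SlowlyVarying L) (u : ℝ) :
    Tendsto (fun x => Real.log (L (Real.exp (x + u))) - Real.log (L (Real.exp x)))
      atTop (𝓝 0) := by
  have h1 := (hL.tendsto _ (Real.exp_pos u)).comp Real.tendsto_exp_atTop
  have h2 := (Real.continuousAt_log one_ne_zero).tendsto.comp h1
  rw [Real.log_one] at h2
  refine h2.congr fun x => ?_
  have a := (hL.pos _ (Real.exp_pos x)).ne'
  have b := (hL.pos _ (mul_pos (Real.exp_pos u) (Real.exp_pos x))).ne'
  simp only [Function.comp]
  rw [Real.log_div b a, Real.exp_add, mul_comm]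

theorem potter (hL : SlowlyVarying L) {δ : ℝ} (hδ : 0 < δ) :
    ∃ r₀ > 0, ∀ r ≥ r₀, ∀ s ≥ r₀,
      |Real.log (L s) - Real.log (L r)| ≤ δ * (|Real.log s - Real.log r| + 1) := by
  obtain ⟨x₀, h⟩ := exists_forall_abs_sub_le hL.measurable_log_exp hL.tendsto_log_exp hδ
  refine ⟨Real.exp x₀, Real.exp_pos _, fun r hr s hs => ?_⟩
  have hr0 := (Real.exp_pos x₀).trans_le hr
  have hs0 := (Real.exp_pos x₀).trans_le hs
  have := h (Real.log r) ((Real.le_log_iff_exp_le hr0).2 hr) (Real.log s)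
    ((Real.le_log_iff_exp_le hs0).2 hs)
  simpa [Real.exp_log hr0, Real.exp_log hs0] using this

/-- Slow variation along a moving argument. -/
theorem tendsto_div_of_tendsto (hL : SlowlyVarying L) {s : ℝ → ℝ} {t : ℝ} (ht : 0 < t)
    (hs : Tendsto (fun r => s r / r) atTop (𝓝 t)) :
    Tendsto (fun r => L (s r) / L r) atTop (𝓝 1) := by
  set l : ℝ → ℝ := fun x => Real.log (L (Real.exp x)) with hl
  have hspos : ∀ᶠ r in atTop, 0 < s r := by
    filter_upwards [hs.eventually (lt_mem_nhds ht), eventually_gt_atTop 0] with r h1 h2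
    exact (div_pos_iff_of_pos_right h2).1 h1
  have hlog : Tendsto (fun r => Real.log (s r) - Real.log r) atTop (𝓝 (Real.log t)) := by
    refine ((Real.continuousAt_log ht.ne').tendsto.comp hs).congr' ?_
    filter_upwards [hspos, eventually_gt_atTop 0] with r h1 h2
    simp [Real.log_div h1.ne' h2.ne']
  -- Eventually `log (s r)` is within `1` of `log r + log t`. Taking `log r + log t - 1` as
  -- intermediate point makes the remaining increment lie in `[0, 2]`, where convergence is uniform.
  have hmain : Tendsto (fun r => l (Real.log (s r)) - l (Real.log r)) atTop (𝓝 0) := by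
    have h1 := (hL.tendsto_log_exp (Real.log t - 1)).comp Real.tendsto_log_atTop
    have h2 : Tendsto (fun r => l (Real.log (s r)) - l (Real.log r + (Real.log t - 1)))
        atTop (𝓝 0) := by
      have h2' : ∀ ε > 0, ∃ x₀, ∀ x ≥ x₀, ∀ u ∈ Icc (0 : ℝ) 2, |l (x + u) - l x| ≤ ε := by
        intro ε hε
        obtain ⟨x₀, h⟩ := exists_forall_abs_sub_le hL.measurable_log_exp hL.tendsto_log_exp
          (δ := ε / 3) (by positivity)
        refine ⟨x₀, fun x hx u hu => (h x hx (x + u) (by linarith [hu.1])).trans ?_⟩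
        rw [add_sub_cancel_left, abs_of_nonneg hu.1]
        nlinarith [hu.2]
      rw [Metric.tendsto_atTop']
      intro ε hε
      obtain ⟨x₀, h⟩ := h2' (ε / 2) (by positivity)
      have hev : ∀ᶠ r in atTop, dist (l (Real.log (s r)) - l (Real.log r + (Real.log t - 1))) 0
          < ε := by
        have ev1 : ∀ᶠ r in atTop, x₀ ≤ Real.log r + (Real.log t - 1) :=
          (tendsto_atTop_add_const_right _ _ Real.tendsto_log_atTop).eventually_ge_atTop x₀
        have ev2 := hlog.eventually (Icc_mem_nhds (show Real.log t - 1 < Real.log t by linarith)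
          (show Real.log t < Real.log t + 1 by linarith))
        filter_upwards [ev1, ev2] with r hr1 hr2
        have := h _ hr1 (Real.log (s r) - (Real.log r + (Real.log t - 1)))
          ⟨by linarith [hr2.1], by linarith [hr2.2]⟩
        rw [add_sub_cancel] at this
        rw [dist_zero_right, Real.norm_eq_abs]
        linarith
      obtain ⟨N, hN⟩ := eventually_atTop.1 hev
      exact ⟨N, fun r hr => hN r hr.le⟩
    have := h2.add h1
    rw [add_zero] at this
    refine this.congr fun r => ?_
    simp [hl]
  have := (Real.continuous_exp.tendsto 0).comp hmain
  rw [Real.exp_zero] at this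
  refine this.congr' ?_
  filter_upwards [hspos, eventually_gt_atTop 0] with r h1 h2
  simp only [hl, Function.comp, Real.exp_log h1, Real.exp_log h2]
  rw [Real.exp_sub, Real.exp_log (hL.pos _ h1), Real.exp_log (hL.pos _ h2)]

end SlowlyVarying

/-! ### Asymptotics and bounds for normalised powers of the covariance -/

section Covariance

variable {B L₀ L : ℝ → ℝ} {α : ℝ}

/-- The normalised power of the covariance along a moving argument. -/
theorem CovarianceAssumption.tendsto_normalized (hcov : CovarianceAssumption B α L₀)
    (hL : SlowlyVarying L) (heq : Tendsto (fun t => L t / L₀ t) atTop (𝓝 1)) (κ : ℕ)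
    {s : ℝ → ℝ} {t : ℝ} (ht : 0 < t) (hs : Tendsto (fun r => s r / r) atTop (𝓝 t)) :
    Tendsto (fun r => B (s r) ^ κ * (r ^ (α * κ) / L r ^ κ)) atTop (𝓝 (t ^ (-(α * κ)))) := by
  have h1 := hcov.slowlyVarying.tendsto_div_of_tendsto ht hs
  have h2 := h1.mul (heq.inv₀ one_ne_zero)
  have h3 : Tendsto (fun r => (s r / r) ^ (-α)) atTop (𝓝 (t ^ (-α))) :=
    hs.rpow_const (Or.inl ht.ne')
  have h4 := (h3.mul h2).pow κ
  rw [inv_one, mul_one, mul_one, ← Real.rpow_mul_natCast ht.le, neg_mul] at h4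
  refine h4.congr' ?_
  filter_upwards [hs.eventually (lt_mem_nhds ht), eventually_gt_atTop 0] with r hr1 hr
  have hsr : 0 < s r := (div_pos_iff_of_pos_right hr).1 hr1
  have hL0 := hcov.slowlyVarying.pos r hr
  have hLr := hL.pos r hr
  rw [hcov.eq_of_pos _ hsr, Real.rpow_mul_natCast hr.le, ← div_pow, ← mul_pow]
  congr 1
  rw [Real.div_rpow hsr.le hr.le, Real.rpow_neg hr.le]
  field_simp

/-- Potter's bound with exponent `(γ - ακ)/κ` loses exactly `γ - ακ` after taking the `κ`-th power.
The restriction `s ≤ M r` bounds `log (r / s)` below, so its absolute value can be replaced by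
itself at the price of a constant. The factor `2 ^ κ` pays for passing from `L` to `L₀`. -/
theorem CovarianceAssumption.exists_normalized_le (hcov : CovarianceAssumption B α L₀)
    (hL : SlowlyVarying L) (heq : Tendsto (fun t => L t / L₀ t) atTop (𝓝 1)) {κ : ℕ}
    (hκ : 1 ≤ κ) {γ M : ℝ} (hγ : α * κ < γ) (hM : 1 ≤ M) :
    ∃ C > 0, ∃ r₀ > 0, ∀ r ≥ r₀, ∀ s ≥ r₀, s ≤ M * r →
      B s ^ κ * (r ^ (α * κ) / L r ^ κ) ≤ C * (r / s) ^ γ := by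
  have hκ0 : (0 : ℝ) < κ := by exact_mod_cast hκ
  set η := γ - α * κ with hη
  have hη0 : 0 < η := by linarith
  obtain ⟨r₁, hr₁, hp⟩ := hcov.slowlyVarying.potter (div_pos hη0 hκ0)
  obtain ⟨r₂, hr₂⟩ := eventually_atTop.1 (heq.eventually (lt_mem_nhds (show (1 / 2 : ℝ) < 1 by norm_num)))
  refine ⟨2 ^ κ * Real.exp (2 * η * Real.log M + η), by positivity, max r₁ r₂,
    lt_max_of_lt_left hr₁, fun r hr s hs hsM => ?_⟩
  have hr0 : 0 < r := hr₁.trans_le ((le_max_left _ _).trans hr)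
  have hs0 : 0 < s := hr₁.trans_le ((le_max_left _ _).trans hs)
  have hL0r := hcov.slowlyVarying.pos r hr0
  have hL0s := hcov.slowlyVarying.pos s hs0
  have hLr := hL.pos r hr0
  have hpot := hp r ((le_max_left _ _).trans hr) s ((le_max_left _ _).trans hs)
  have hl2 := hr₂ r ((le_max_right _ _).trans hr)
  have hLL : L₀ r / L r ≤ 2 := by
    rw [lt_div_iff₀ hL0r] at hl2
    rw [div_le_iff₀ hLr]; linarith
  set τ := Real.log r - Real.log s with hτ
  have hτM : -Real.log M ≤ τ := by
    have := Real.log_le_log hs0 hsM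
    rw [Real.log_mul (by positivity) hr0.ne'] at this
    linarith
  have hlogM := Real.log_nonneg hM
  have hτabs : |Real.log s - Real.log r| ≤ τ + 2 * Real.log M := by
    rw [abs_le]; constructor <;> linarith
  have e1 : B s * (r ^ α / L r)
      = Real.exp (α * τ + (Real.log (L₀ s) - Real.log (L₀ r))) * (L₀ r / L r) := by
    rw [hcov.eq_of_pos s hs0, Real.exp_add, Real.exp_sub, Real.exp_log hL0s, Real.exp_log hL0r,
      Real.rpow_def_of_pos hs0, Real.rpow_def_of_pos hr0, hτ, mul_sub, Real.exp_sub,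
      mul_neg, Real.exp_neg, mul_comm α, mul_comm α]
    field_simp
  have e2 : (r / s) ^ γ = Real.exp (γ * τ) := by
    rw [Real.rpow_def_of_pos (by positivity), Real.log_div hr0.ne' hs0.ne', mul_comm]
  rw [Real.rpow_mul_natCast hr0.le, ← div_pow, ← mul_pow, e1, e2, mul_pow, ← Real.exp_nat_mul]
  have b1 : (κ : ℝ) * (α * τ + (Real.log (L₀ s) - Real.log (L₀ r)))
      ≤ γ * τ + (2 * η * Real.log M + η) := by
    have h1 : Real.log (L₀ s) - Real.log (L₀ r) ≤ η / κ * (τ + 2 * Real.log M + 1) :=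
      (le_abs_self _).trans (hpot.trans (by gcongr))
    have h2 := mul_le_mul_of_nonneg_left h1 hκ0.le
    have h3 : (κ : ℝ) * (η / κ * (τ + 2 * Real.log M + 1)) = η * (τ + 2 * Real.log M + 1) := by
      field_simp
    rw [h3] at h2
    have h4 : γ = η + α * κ := by rw [hη]; ring
    rw [h4]; nlinarith
  calc _ ≤ Real.exp (γ * τ + (2 * η * Real.log M + η)) * 2 ^ κ := by
        gcongr
    _ = _ := by rw [Real.exp_add]; ring

/-- Here `s` is a sampled distance and `r d` the true one, with a bounded error. If `r d` is large,
then `s` is comparable to it and Potter's bound applies. Otherwise only `|B| ≤ 1` is available, but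
then `r` is at most a constant over `d`, and the normalisation grows no faster than `r ^ γ`. -/
theorem CovarianceAssumption.exists_normalized_le_rpow (hcov : CovarianceAssumption B α L₀)
    (hL : SlowlyVarying L) (heq : Tendsto (fun t => L t / L₀ t) atTop (𝓝 1)) {κ : ℕ}
    (hκ : 1 ≤ κ) (hB : ∀ s, 0 ≤ s → |B s| ≤ 1) {γ M c : ℝ} (hγ : α * κ < γ) (hM : 1 ≤ M)
    (hc : 0 < c) :
    ∃ C > 0, ∃ r₀ > 0, ∀ r ≥ r₀, ∀ s d, 0 ≤ s → s ≤ M * r → 0 < d → |s - r * d| ≤ c →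
      |B s| ^ κ * (r ^ (α * κ) / L r ^ κ) ≤ C * d ^ (-γ) := by
  obtain ⟨C, hC, r₀, hr₀, h⟩ := hcov.exists_normalized_le hL heq hκ hγ hM
  have hγ0 : 0 < γ := lt_of_le_of_lt (mul_nonneg hcov.alpha_pos.le (Nat.cast_nonneg _)) hγ
  have hBpos : ∀ s, 0 < s → 0 < B s := fun s hs => by
    rw [hcov.eq_of_pos s hs]
    exact mul_pos (Real.rpow_pos_of_pos hs _) (hcov.slowlyVarying.pos s hs)
  -- Above this threshold the error `c` is at most half of `r d`, so `s ≥ r d / 2`, which also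
  -- exceeds `r₀`.
  set m := max (2 * c) (2 * r₀) with hm
  have hm0 : 0 < m := lt_max_of_lt_left (by positivity)
  have hB0 := hBpos r₀ hr₀
  set C₁ := C * r₀ ^ (-γ) / B r₀ ^ κ with hC₁
  have hC₁0 : 0 < C₁ := by positivity
  refine ⟨max (C₁ * m ^ γ) (C * 2 ^ γ), lt_max_of_lt_left (by positivity), r₀, hr₀,
    fun r hr s d hs hsM hd hsd => ?_⟩
  have hr0 := hr₀.trans_le hr
  have hLr := hL.pos r hr0
  have hdγ : 0 < d ^ (-γ) := Real.rpow_pos_of_pos hd _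
  have hnorm0 : 0 ≤ r ^ (α * κ) / L r ^ κ := by positivity
  rcases le_or_gt (r * d) m with hrd | hrd
  -- Applying the previous bound at the fixed argument `r₀` bounds the normalisation itself by a
  -- multiple of `r ^ γ`.
  · have h1 := h r hr r₀ le_rfl (hr.trans (le_mul_of_one_le_left hr0.le hM))
    have h2 : r ^ (α * κ) / L r ^ κ ≤ C₁ * r ^ γ := by
      rw [Real.div_rpow hr0.le hr₀.le] at h1
      rw [hC₁, Real.rpow_neg hr₀.le, div_mul_eq_mul_div, le_div_iff₀ (by positivity)]
      calc _ = B r₀ ^ κ * (r ^ (α * κ) / L r ^ κ) := mul_comm _ _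
        _ ≤ _ := h1
        _ = _ := by ring
    calc |B s| ^ κ * (r ^ (α * κ) / L r ^ κ) ≤ 1 * (C₁ * r ^ γ) := by
          refine mul_le_mul (pow_le_one₀ (abs_nonneg _) (hB s hs)) h2 hnorm0 zero_le_one
      _ ≤ 1 * (C₁ * (m / d) ^ γ) := by
          have : r ≤ m / d := by rwa [le_div_iff₀ hd]
          gcongr
      _ = C₁ * m ^ γ * d ^ (-γ) := by
          rw [Real.div_rpow hm0.le hd.le, Real.rpow_neg hd.le]; ring
      _ ≤ _ := by gcongr; exact le_max_left _ _
  · have hm1 : 2 * c ≤ m := le_max_left _ _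
    have hm2 : 2 * r₀ ≤ m := le_max_right _ _
    have hs1 : r * d / 2 ≤ s := by linarith [(abs_le.1 hsd).1]
    have hs2 : r₀ ≤ s := by linarith
    have hs3 : 0 < s := hr₀.trans_le hs2
    have h1 := h r hr s hs2 hsM
    rw [abs_of_pos (hBpos s hs3)]
    calc _ ≤ C * (r / s) ^ γ := h1
      _ ≤ C * (2 / d) ^ γ := by
          have : r / s ≤ 2 / d := by rw [div_le_div_iff₀ hs3 hd]; linarith
          gcongr
      _ = C * 2 ^ γ * d ^ (-γ) := by
          rw [Real.div_rpow zero_le_two hd.le, Real.rpow_neg hd.le]; ring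
      _ ≤ _ := by gcongr; exact le_max_right _ _

end Covariance

/-! ### Second-order properties of the Gaussian field -/

section Field

variable {n : ℕ} {Ω : Type*} [MeasurableSpace Ω] {P : Measure Ω}
  {ξ : EuclideanSpace ℝ (Fin n) → Ω → ℝ} {B : ℝ → ℝ}

theorem IsHomogeneousIsotropicGaussianField.integral_hermiteFun_mul [IsProbabilityMeasure P]
    (hξ : IsHomogeneousIsotropicGaussianField P ξ B) (h0 : B 0 = 1) (κ : ℕ)
    (x y : EuclideanSpace ℝ (Fin n)) :
    ∫ ω, hermiteFun κ (ξ x ω) * hermiteFun κ (ξ y ω) ∂P = B ‖x - y‖ ^ κ * κ.factorial := by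
  rw [integral_hermiteFun_mul_hermiteFun κ hξ.gaussian.hasGaussianLaw_prodMk (hξ.mean_zero x)
    (hξ.mean_zero y) (by simp [hξ.cov, h0]) (by simp [hξ.cov, h0]), hξ.cov]

theorem IsHomogeneousIsotropicGaussianField.memLp_hermiteFun
    (hξ : IsHomogeneousIsotropicGaussianField P ξ B) (h0 : B 0 = 1) (κ : ℕ)
    (x : EuclideanSpace ℝ (Fin n)) : MemLp (fun ω => hermiteFun κ (ξ x ω)) 2 P :=
  memLp_hermiteFun_comp κ (hξ.gaussian.hasGaussianLaw_eval x) (hξ.mean_zero x)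
    (by simp [hξ.cov, h0])

theorem IsHomogeneousIsotropicGaussianField.abs_cov_le_one
    (hξ : IsHomogeneousIsotropicGaussianField P ξ B) (h0 : B 0 = 1)
    (x y : EuclideanSpace ℝ (Fin n)) : |B ‖x - y‖| ≤ 1 := by
  have hm : ∀ z, MemLp (ξ z) 2 P := fun z => (hξ.gaussian.hasGaussianLaw_eval z).memLp_two
  have key : ∀ c : ℝ, 0 ≤ 1 + 2 * c * B ‖x - y‖ + c ^ 2 := by
    intro c
    have h : 0 ≤ ∫ ω, (ξ x ω + c * ξ y ω) ^ 2 ∂P := integral_nonneg fun ω => sq_nonneg _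
    have e : ∀ ω, (ξ x ω + c * ξ y ω) ^ 2
        = ξ x ω * ξ x ω + 2 * c * (ξ x ω * ξ y ω) + c ^ 2 * (ξ y ω * ξ y ω) := fun ω => by ring
    have i1 : Integrable (fun ω => ξ x ω * ξ x ω) P := (hm x).integrable_mul (hm x)
    have i2 : Integrable (fun ω => 2 * c * (ξ x ω * ξ y ω)) P :=
      ((hm x).integrable_mul (hm y)).const_mul _
    have i3 : Integrable (fun ω => c ^ 2 * (ξ y ω * ξ y ω)) P :=
      ((hm y).integrable_mul (hm y)).const_mul _
    simp_rw [e] at h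
    rw [integral_add (f := fun ω => ξ x ω * ξ x ω + 2 * c * (ξ x ω * ξ y ω)) (i1.add i2) i3,
      integral_add i1 i2, integral_const_mul, integral_const_mul,
      hξ.cov, hξ.cov, hξ.cov] at h
    simpa [h0] using h
  rw [abs_le]
  constructor
  · linarith [key 1]
  · linarith [key (-1)]

theorem IsHomogeneousIsotropicGaussianField.abs_le_one (hn : 1 ≤ n)
    (hξ : IsHomogeneousIsotropicGaussianField P ξ B) (h0 : B 0 = 1) {s : ℝ} (hs : 0 ≤ s) :
    |B s| ≤ 1 := by
  have := hξ.abs_cov_le_one h0 (EuclideanSpace.single (⟨0, hn⟩ : Fin n) s) 0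
  simpa [abs_of_nonneg hs] using this

end Field

/-! ### Geometry of the window and its lattice set -/

section Window

variable {n : ℕ} {lo up : (k : ℕ) → (Fin k → ℝ) → ℝ} {r : ℝ}

/-- The first `k` coordinates of a vector. -/
def firstCoords {β : Type*} {n : ℕ} (k : ℕ) (hk : k ≤ n) (x : Fin n → β) : Fin k → β :=
  fun j => x (Fin.castLE hk j)

theorem mem_region_iff (x : Fin n → ℝ) : x ∈ region lo up n ↔ ∀ k (hk : k < n),
    lo k (firstCoords k hk.le x) ≤ x ⟨k, hk⟩ ∧ x ⟨k, hk⟩ ≤ up k (firstCoords k hk.le x) := by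
  induction n with
  | zero => simp [region]
  | succ n ih =>
    simp only [region, mem_ofPred_eq, ih]
    constructor
    · rintro ⟨h1, h2, h3⟩ k hk
      rcases Nat.lt_succ_iff_lt_or_eq.1 hk with h | rfl
      · exact h1 k h
      · exact ⟨h2, h3⟩
    · intro h
      exact ⟨fun k hk => h k (hk.trans n.lt_succ_self), (h n n.lt_succ_self).1,
        (h n n.lt_succ_self).2⟩

theorem mem_latticeSet_iff (i : Fin n → ℤ) : i ∈ latticeSet lo up r n ↔ ∀ k (hk : k < n),
    (cellPart lo up r (firstCoords k hk.le i)).Nonempty ∧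
    lowerIndex lo up r (firstCoords k hk.le i) ≤ i ⟨k, hk⟩ ∧
    i ⟨k, hk⟩ ≤ upperIndex lo up r (firstCoords k hk.le i) := by
  induction n with
  | zero => simpa [latticeSet] using Subsingleton.elim _ _
  | succ n ih =>
    have hsucc : i ∈ latticeSet lo up r (n + 1) ↔
        (fun j : Fin n => i j.castSucc) ∈ latticeSet lo up r n ∧
        (cellPart lo up r (fun j : Fin n => i j.castSucc)).Nonempty ∧
        lowerIndex lo up r (fun j : Fin n => i j.castSucc) ≤ i (Fin.last n) ∧
        i (Fin.last n) ≤ upperIndex lo up r (fun j : Fin n => i j.castSucc) := by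
      simp only [latticeSet, Finset.mem_biUnion]
      constructor
      · rintro ⟨i', hi', hmem⟩
        split_ifs at hmem with hne
        · simp only [Finset.mem_image, Finset.mem_Icc] at hmem
          obtain ⟨m, hm, rfl⟩ := hmem
          simp only [Fin.snoc_castSucc, Fin.snoc_last]
          exact ⟨hi', hne, hm⟩
        · simp at hmem
      · rintro ⟨h1, h2, h3⟩
        refine ⟨_, h1, ?_⟩
        rw [if_pos h2]
        simp only [Finset.mem_image, Finset.mem_Icc]
        exact ⟨i (Fin.last n), h3, Fin.snoc_init_self i⟩
    rw [hsucc, ih]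
    constructor
    · rintro ⟨h1, h2⟩ k hk
      rcases Nat.lt_succ_iff_lt_or_eq.1 hk with h | rfl
      · exact h1 k h
      · exact h2
    · intro h
      exact ⟨fun k hk => h k (hk.trans n.lt_succ_self), h n n.lt_succ_self⟩

theorem firstCoords_mem_region {x : Fin n → ℝ} (hx : x ∈ region lo up n) (k : ℕ) (hk : k ≤ n) :
    firstCoords k hk x ∈ region lo up k :=
  (mem_region_iff _).2 fun j hj => (mem_region_iff x).1 hx j (hj.trans_le hk)

theorem snoc_mem_region {k : ℕ} {x : Fin k → ℝ} {c : ℝ} :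
    Fin.snoc (α := fun _ => ℝ) x c ∈ region lo up (k + 1) ↔
      x ∈ region lo up k ∧ lo k x ≤ c ∧ c ≤ up k x := by
  simp [region]

/-- Append the lower boundary value one coordinate at a time. This carries information from the
compact top-dimensional window down to every `Δ_k`. -/
theorem exists_firstCoords_eq (hle : ∀ k < n, ∀ x ∈ region lo up k, lo k x ≤ up k x) {k : ℕ}
    (hk : k ≤ n) {x : Fin k → ℝ} (hx : x ∈ region lo up k) :
    ∃ y ∈ region lo up n, firstCoords k hk y = x := by
  induction n with
  | zero =>
    obtain rfl := Nat.le_zero.1 hk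
    exact ⟨x, hx, rfl⟩
  | succ n ih =>
    rcases Nat.le_succ_iff.1 hk with h | rfl
    · obtain ⟨y, hy, hyx⟩ := ih (fun k hk => hle k (hk.trans n.lt_succ_self)) h
      refine ⟨Fin.snoc (α := fun _ => ℝ) y (lo n y),
        snoc_mem_region.2 ⟨hy, le_rfl, hle n n.lt_succ_self y hy⟩, ?_⟩
      rw [← hyx]
      ext j
      exact Fin.snoc_castSucc (α := fun _ => ℝ) (lo n y) y (Fin.castLE h j)
    · exact ⟨x, hx, rfl⟩

/-- Boundary values are themselves coordinates of points of the compact window. The bound ensures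
that the infima and suprema defining the lattice set are genuine. -/
theorem IsWindow.exists_bound (hΔ : IsWindow n lo up) :
    ∃ R : ℝ, ∀ k < n, ∀ x ∈ region lo up k, |lo k x| ≤ R ∧ |up k x| ≤ R := by
  obtain ⟨R, hR⟩ := hΔ.compact.isBounded.exists_norm_le
  have hcoord : ∀ k (hk : k < n), ∀ x ∈ region lo up k, ∀ c, lo k x ≤ c → c ≤ up k x →
      |c| ≤ R := by
    intro k hk x hx c h1 h2
    obtain ⟨y, hy, hyx⟩ := exists_firstCoords_eq hΔ.le hk
      (snoc_mem_region.2 ⟨hx, h1, h2⟩)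
    have e : y ⟨k, hk⟩ = c := by
      have := congrFun hyx (Fin.last k)
      rw [Fin.snoc_last] at this
      exact this
    have h3 := hR (WithLp.toLp 2 y) (show _ ∈ region lo up n from hy)
    have h4 := PiLp.norm_apply_le (WithLp.toLp 2 y) ⟨k, hk⟩
    rw [← e]
    exact h4.trans h3
  exact ⟨R, fun k hk x hx => ⟨hcoord k hk x hx _ le_rfl (hΔ.le k hk x hx),
    hcoord k hk x hx _ (hΔ.le k hk x hx) le_rfl⟩⟩

theorem inv_smul_mem_of_mem_cellPart (hr : 0 < r) {k : ℕ} {i : Fin k → ℤ} {z : Fin k → ℝ}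
    (hz : z ∈ cellPart lo up r i) : r⁻¹ • z ∈ region lo up k :=
  (mem_smul_set_iff_inv_smul_mem₀ hr.ne' _ _).1 hz.1

theorem IsWindow.bddBelow_cell (hΔ : IsWindow n lo up) (hr : 0 < r) {k : ℕ} (hk : k < n)
    (i : Fin k → ℤ) : BddBelow (scaled r (lo k) '' cellPart lo up r i) := by
  obtain ⟨R, hR⟩ := hΔ.exists_bound
  refine ⟨r * -R, ?_⟩
  rintro _ ⟨z, hz, rfl⟩
  exact mul_le_mul_of_nonneg_left
    (abs_le.1 (hR k hk _ (inv_smul_mem_of_mem_cellPart hr hz)).1).1 hr.le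

theorem IsWindow.bddAbove_cell (hΔ : IsWindow n lo up) (hr : 0 < r) {k : ℕ} (hk : k < n)
    (i : Fin k → ℤ) : BddAbove (scaled r (up k) '' cellPart lo up r i) := by
  obtain ⟨R, hR⟩ := hΔ.exists_bound
  refine ⟨r * R, ?_⟩
  rintro _ ⟨z, hz, rfl⟩
  exact mul_le_mul_of_nonneg_left
    (abs_le.1 (hR k hk _ (inv_smul_mem_of_mem_cellPart hr hz)).2).2 hr.le

/-- The dimension-dependent rounding enters the argument only through this bound and the next one.
-/
theorem floor_le_upperIndex {k : ℕ} (i : Fin k → ℤ) :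
    ⌊sSup (scaled r (up k) '' cellPart lo up r i)⌋ ≤ upperIndex lo up r i := by
  unfold upperIndex
  split_ifs
  · exact Int.floor_le_ceil _
  · exact le_rfl

theorem upperIndex_le_ceil {k : ℕ} (i : Fin k → ℤ) :
    upperIndex lo up r i ≤ ⌈sSup (scaled r (up k) '' cellPart lo up r i)⌉ := by
  unfold upperIndex
  split_ifs
  · exact le_rfl
  · exact Int.floor_le_ceil _

/-- The lattice points below the points of the dilated window belong to the lattice set. -/
theorem IsWindow.floor_mem_latticeSet (hΔ : IsWindow n lo up) (hr : 0 < r) {u : Fin n → ℝ}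
    (hu : u ∈ region lo up n) : (fun j => ⌊r * u j⌋) ∈ latticeSet lo up r n := by
  rw [mem_latticeSet_iff]
  intro k hk
  set u' := firstCoords k hk.le u with hu'
  have hmem : r • u' ∈ cellPart lo up r (firstCoords k hk.le fun j => ⌊r * u j⌋) := by
    refine ⟨smul_mem_smul_set (firstCoords_mem_region hu k hk.le), fun j => ?_⟩
    refine ⟨Int.floor_le _, (Int.lt_floor_add_one _).le, fun _ => Int.lt_floor_add_one _⟩
  have hsc : ∀ f : (Fin k → ℝ) → ℝ, scaled r f (r • u') = r * f u' := fun f => by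
    rw [scaled, inv_smul_smul₀ hr.ne']
  have hk' := (mem_region_iff u).1 hu k hk
  refine ⟨⟨_, hmem⟩, Int.floor_le_floor ?_, le_trans (Int.floor_le_floor ?_)
    (floor_le_upperIndex _)⟩
  · refine (csInf_le (hΔ.bddBelow_cell hr hk _) ⟨_, hmem, rfl⟩).trans ?_
    rw [hsc]
    exact mul_le_mul_of_nonneg_left hk'.1 hr.le
  · refine le_trans ?_ (le_csSup (hΔ.bddAbove_cell hr hk _) ⟨_, hmem, rfl⟩)
    rw [hsc]
    exact mul_le_mul_of_nonneg_left hk'.2 hr.le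

theorem eventually_forall_cellPart_dist_lt {k : ℕ} (u : Fin k → ℝ) {η : ℝ} (hη : 0 < η) :
    ∀ᶠ r : ℝ in atTop, ∀ z ∈ cellPart lo up r (fun j => ⌊r * u j⌋), dist (r⁻¹ • z) u < η := by
  filter_upwards [eventually_gt_atTop (1 / η), eventually_gt_atTop 0] with r hr hr0 z hz
  refine (dist_pi_lt_iff hη).2 fun j => ?_
  have h1 := (hz.2 j).1
  have h2 := (hz.2 j).2.1
  have h3 := Int.floor_le (r * u j)
  have h4 := Int.lt_floor_add_one (r * u j)
  rw [div_lt_iff₀ hη] at hr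
  have e : (r⁻¹ • z) j - u j = r⁻¹ * (z j - r * u j) := by
    simp only [Pi.smul_apply, smul_eq_mul]; field_simp
  rw [Real.dist_eq, e, abs_mul, abs_of_pos (inv_pos.2 hr0), inv_mul_lt_iff₀ hr0]
  refine lt_of_le_of_lt ?_ hr
  rw [abs_le]; constructor <;> linarith

/-- Over a point outside the window at which the boundary functions are continuous, there are no
lattice points for large dilations. -/
theorem eventually_floor_notMem_latticeSet {u : Fin n → ℝ} (hu : u ∉ region lo up n)
    (hcont : ∀ k (hk : k < n), firstCoords k hk.le u ∈ region lo up k →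
      ContinuousWithinAt (lo k) (region lo up k) (firstCoords k hk.le u) ∧
      ContinuousWithinAt (up k) (region lo up k) (firstCoords k hk.le u)) :
    ∀ᶠ r : ℝ in atTop, (fun j => ⌊r * u j⌋) ∉ latticeSet lo up r n := by
  classical
  -- Take the first coordinate at which a constraint fails. The preceding coordinates then form a
  -- point of `Δ_k`, where continuity of the boundary functions is available.
  have hex : ∃ k, ∃ hk : k < n, ¬ (lo k (firstCoords k hk.le u) ≤ u ⟨k, hk⟩ ∧
      u ⟨k, hk⟩ ≤ up k (firstCoords k hk.le u)) := by
    rw [mem_region_iff] at hu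
    push Not at hu ⊢
    exact hu
  obtain ⟨hk, hout⟩ := Nat.find_spec hex
  have hmin := fun j (hj : j < Nat.find hex) => Nat.find_min hex hj
  set k := Nat.find hex
  set u' := firstCoords k hk.le u with hu'
  have hu'mem : u' ∈ region lo up k := by
    rw [mem_region_iff]
    intro j hj
    have := hmin j hj
    push Not at this
    by_contra hcon
    have hjn := hj.trans hk
    rw [not_and_or, not_le, not_le] at hcon
    rcases hcon with hcon | hcon
    · by_cases h : lo j (firstCoords j hjn.le u) ≤ u ⟨j, hjn⟩
      · exact absurd h (not_le.2 hcon)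
      · exact hmin j hj ⟨hjn, fun hh => h hh.1⟩
    · exact hmin j hj ⟨hjn, fun hh => absurd hh.2 (not_le.2 hcon)⟩
  obtain ⟨hcl, hcu⟩ := hcont k hk hu'mem
  rw [not_and_or, not_le, not_le] at hout
  rcases hout with hout | hout
  · set δ := lo k u' - u ⟨k, hk⟩ with hδ
    have hδ0 : 0 < δ := by linarith
    obtain ⟨η, hη, hball⟩ := Metric.continuousWithinAt_iff.1 hcl (δ / 2) (by positivity)
    -- For `r > 4 / δ` the remaining gap `r δ / 2` exceeds `2`, which beats the rounding error: at
    -- most `1` here, and `2` in the upper case.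
    filter_upwards [eventually_forall_cellPart_dist_lt (lo := lo) (up := up) u' hη,
      eventually_gt_atTop 0, eventually_gt_atTop (4 / δ)] with r hr hr0 hrδ hmem
    obtain ⟨hne, hlow, -⟩ := (mem_latticeSet_iff _).1 hmem k hk
    rw [div_lt_iff₀ hδ0] at hrδ
    have hinf : r * (lo k u' - δ / 2) ≤
        sInf (scaled r (lo k) '' cellPart lo up r (firstCoords k hk.le fun j => ⌊r * u j⌋)) := by
      refine le_csInf (hne.image _) ?_
      rintro _ ⟨z, hz, rfl⟩
      have h1 := hball (inv_smul_mem_of_mem_cellPart hr0 hz) (hr z hz)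
      rw [Real.dist_eq] at h1
      exact mul_le_mul_of_nonneg_left (by linarith [(abs_lt.1 h1).1]) hr0.le
    have h2 := Int.lt_floor_add_one (sInf (scaled r (lo k) ''
      cellPart lo up r (firstCoords k hk.le fun j => ⌊r * u j⌋)))
    have h3 : ((lowerIndex lo up r (firstCoords k hk.le fun j => ⌊r * u j⌋) : ℤ) : ℝ)
        ≤ (⌊r * u ⟨k, hk⟩⌋ : ℝ) := by exact_mod_cast hlow
    have h4 := Int.floor_le (r * u ⟨k, hk⟩)
    simp only [lowerIndex] at h3
    nlinarith
  · set δ := u ⟨k, hk⟩ - up k u' with hδ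
    have hδ0 : 0 < δ := by linarith
    obtain ⟨η, hη, hball⟩ := Metric.continuousWithinAt_iff.1 hcu (δ / 2) (by positivity)
    filter_upwards [eventually_forall_cellPart_dist_lt (lo := lo) (up := up) u' hη,
      eventually_gt_atTop 0, eventually_gt_atTop (4 / δ)] with r hr hr0 hrδ hmem
    obtain ⟨hne, -, hupp⟩ := (mem_latticeSet_iff _).1 hmem k hk
    rw [div_lt_iff₀ hδ0] at hrδ
    have hsup : sSup (scaled r (up k) ''
        cellPart lo up r (firstCoords k hk.le fun j => ⌊r * u j⌋)) ≤ r * (up k u' + δ / 2) := by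
      refine csSup_le (hne.image _) ?_
      rintro _ ⟨z, hz, rfl⟩
      have h1 := hball (inv_smul_mem_of_mem_cellPart hr0 hz) (hr z hz)
      rw [Real.dist_eq] at h1
      exact mul_le_mul_of_nonneg_left (by linarith [(abs_lt.1 h1).2]) hr0.le
    have h2 := Int.ceil_lt_add_one (sSup (scaled r (up k) ''
      cellPart lo up r (firstCoords k hk.le fun j => ⌊r * u j⌋)))
    have h3 : (⌊r * u ⟨k, hk⟩⌋ : ℝ) ≤ (⌈sSup (scaled r (up k) ''
      cellPart lo up r (firstCoords k hk.le fun j => ⌊r * u j⌋))⌉ : ℝ) := by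
      exact_mod_cast hupp.trans (upperIndex_le_ceil _)
    have h4 := Int.lt_floor_add_one (r * u ⟨k, hk⟩)
    nlinarith

theorem SmoothExceptJumps.continuousWithinAt {k : ℕ} {D : Set (Fin k → ℝ)}
    {f : (Fin k → ℝ) → ℝ} (h : SmoothExceptJumps D f) :
    ∃ J : Fin k → Finset ℝ, ∀ p ∈ D, (∀ m, p m ∉ J m) → ContinuousWithinAt f D p := by
  obtain ⟨J, hJ, -⟩ := h
  refine ⟨J, fun p hp hpJ => ?_⟩
  have hclosed : IsClosed {x : Fin k → ℝ | ∃ m, x m ∈ J m} := by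
    rw [ofPred_exists]
    exact isClosed_iUnion_of_finite fun m =>
      (J m).finite_toSet.isClosed.preimage (continuous_apply m)
  have hp' : p ∉ {x : Fin k → ℝ | ∃ m, x m ∈ J m} := by simpa using hpJ
  refine (hJ.continuousOn p ⟨hp, hp'⟩).mono_of_mem_nhdsWithin ?_
  exact inter_mem_nhdsWithin D (hclosed.isOpen_compl.mem_nhds hp')

theorem ae_apply_notMem (j : Fin n) (J : Finset ℝ) :
    ∀ᵐ u : EuclideanSpace ℝ (Fin n), u j ∉ J := by
  have h1 : ∀ᵐ x : Fin n → ℝ, x j ∉ J := by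
    have : ∀ c ∈ J, ∀ᵐ x : Fin n → ℝ, x j ≠ c := fun c _ => by
      rw [volume_pi]
      exact Measure.ae_eval_ne (μ := fun _ : Fin n => (volume : Measure ℝ)) j c
    filter_upwards [(J.eventually_all).2 this] with x hx hxJ
    exact hx _ hxJ rfl
  exact (PiLp.volume_preserving_ofLp (Fin n)).quasiMeasurePreserving.ae h1

/-- A jump hyperplane of a boundary function on `ℝᵏ` lifts to a coordinate hyperplane of `ℝⁿ`, which
is null. -/
theorem IsWindow.ae_continuousWithinAt (hΔ : IsWindow n lo up) :
    ∀ᵐ u : EuclideanSpace ℝ (Fin n), ∀ k (hk : k < n),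
      firstCoords k hk.le u.ofLp ∈ region lo up k →
      ContinuousWithinAt (lo k) (region lo up k) (firstCoords k hk.le u.ofLp) ∧
      ContinuousWithinAt (up k) (region lo up k) (firstCoords k hk.le u.ofLp) := by
  rw [ae_all_iff]; intro k
  rw [ae_all_iff]; intro hk
  obtain ⟨J₁, h₁⟩ := (hΔ.smooth_lo k hk).continuousWithinAt
  obtain ⟨J₂, h₂⟩ := (hΔ.smooth_up k hk).continuousWithinAt
  have e₁ : ∀ᵐ u : EuclideanSpace ℝ (Fin n), ∀ m, u (Fin.castLE hk.le m) ∉ J₁ m :=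
    ae_all_iff.2 fun m => ae_apply_notMem _ _
  have e₂ : ∀ᵐ u : EuclideanSpace ℝ (Fin n), ∀ m, u (Fin.castLE hk.le m) ∉ J₂ m :=
    ae_all_iff.2 fun m => ae_apply_notMem _ _
  filter_upwards [e₁, e₂] with u hu₁ hu₂ hu
  exact ⟨h₁ _ hu hu₁, h₂ _ hu hu₂⟩

theorem EuclideanSpace.norm_le_card_mul {c : ℝ} {x : EuclideanSpace ℝ (Fin n)}
    (h : ∀ j, |x j| ≤ c) : ‖x‖ ≤ n * c := by
  have e : x = ∑ j, EuclideanSpace.single j (x j) := by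
    ext i
    simp [WithLp.ofLp_sum, Finset.sum_apply, Pi.single_apply]
  rw [e]
  refine (norm_sum_le _ _).trans ?_
  calc ∑ j, ‖EuclideanSpace.single j (x j)‖ ≤ ∑ _j : Fin n, c :=
        Finset.sum_le_sum fun j _ => by simpa using h j
    _ = n * c := by simp

/-- If a dilate of the window is a neighbourhood of the window, it contains the rescaled lattice
points for large dilations. -/
theorem IsWindow.eventually_latticePoint_mem (hn : 1 ≤ n) (hΔ : IsWindow n lo up) {μ : ℝ}
    (hμ : 0 < μ) (hsub : window lo up n ⊆ interior (μ • window lo up n)) :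
    ∀ᶠ r : ℝ in atTop, ∀ i ∈ latticeSet lo up r n,
      r⁻¹ • latticePoint i ∈ μ • window lo up n := by
  obtain ⟨m, rfl⟩ : ∃ m, n = m + 1 := ⟨n - 1, by omega⟩
  obtain ⟨η, hη, hthick⟩ := hΔ.compact.exists_thickening_subset_open isOpen_interior hsub
  have hnear : ∀ p ∈ region lo up (m + 1), ∀ q : Fin (m + 1) → ℝ, ∀ c,
      (∀ j, |q j - p j| ≤ c) → (m + 1) * c < η → μ⁻¹ • q ∈ region lo up (m + 1) := by
    intro p hp q c hpq hc
    have h1 : (WithLp.toLp 2 q : EuclideanSpace ℝ (Fin (m + 1))) ∈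
        Metric.thickening η (window lo up (m + 1)) := by
      refine Metric.mem_thickening_iff.2 ⟨WithLp.toLp 2 p, hp, ?_⟩
      rw [dist_eq_norm]
      refine lt_of_le_of_lt (EuclideanSpace.norm_le_card_mul (c := c) fun j => ?_) ?_
      · simpa using hpq j
      · exact_mod_cast hc
    have h2 := interior_subset (hthick h1)
    exact (mem_smul_set_iff_inv_smul_mem₀ hμ.ne' (window lo up (m + 1)) _).1 h2
  filter_upwards [eventually_gt_atTop 0, eventually_gt_atTop ((m + 1) * 2 / η)] with r hr0 hr i hi
  rw [div_lt_iff₀ hη] at hr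
  have hc : ((m : ℝ) + 1) * (2 / r) < η := by
    rw [← mul_div_assoc, div_lt_iff₀ hr0]; linarith
  obtain ⟨hne, hlow, hupp⟩ := (mem_latticeSet_iff _).1 hi m m.lt_succ_self
  have hupp := hupp.trans (upperIndex_le_ceil _)
  set i' := firstCoords m m.lt_succ_self.le i with hi'
  set t : ℝ := r⁻¹ * i (Fin.last m) with ht
  set y : Fin m → ℝ := fun j => r⁻¹ * i' j with hy
  have hcell : ∀ z ∈ cellPart lo up r i', ∀ j, |y j - (r⁻¹ • z) j| ≤ 2 / r := by
    intro z hz j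
    have e : y j - (r⁻¹ • z) j = r⁻¹ * (i' j - z j) := by
      simp only [hy, Pi.smul_apply, smul_eq_mul]; ring
    rw [e, abs_mul, abs_of_pos (inv_pos.2 hr0), inv_mul_eq_div]
    gcongr
    rw [abs_le]
    constructor <;> linarith [(hz.2 j).1, (hz.2 j).2.1]
  obtain ⟨_, ⟨z₁, hz₁, rfl⟩, hinf⟩ := exists_lt_of_csInf_lt (hne.image (scaled r (lo m)))
    (lt_add_one _)
  obtain ⟨_, ⟨z₂, hz₂, rfl⟩, hsup⟩ := exists_lt_of_lt_csSup (hne.image (scaled r (up m)))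
    (sub_one_lt _)
  have hy₁ := inv_smul_mem_of_mem_cellPart hr0 hz₁
  have hy₂ := inv_smul_mem_of_mem_cellPart hr0 hz₂
  have hlowt : lo m (r⁻¹ • z₁) - t ≤ 2 / r := by
    have h1 : (⌊sInf (scaled r (lo m) '' cellPart lo up r i')⌋ : ℝ) ≤ i (Fin.last m) := by
      exact_mod_cast hlow
    have h2 := Int.lt_floor_add_one (sInf (scaled r (lo m) '' cellPart lo up r i'))
    rw [le_div_iff₀ hr0, sub_mul, ht, mul_comm, mul_right_comm, inv_mul_cancel₀ hr0.ne', one_mul]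
    simp only [scaled] at hinf h1 h2
    linarith
  have huppt : t - up m (r⁻¹ • z₂) ≤ 2 / r := by
    have h1 : (i (Fin.last m) : ℝ) ≤ (⌈sSup (scaled r (up m) '' cellPart lo up r i')⌉ : ℝ) := by
      exact_mod_cast hupp
    have h2 := Int.ceil_lt_add_one (sSup (scaled r (up m) '' cellPart lo up r i'))
    rw [le_div_iff₀ hr0, sub_mul, ht, mul_right_comm, inv_mul_cancel₀ hr0.ne', one_mul,
      mul_comm _ r]
    simp only [scaled] at hsup h1 h2
    linarith
  have h2r : 0 ≤ 2 / r := by positivity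
  -- A lattice point need not be near the window, since the boundary functions may jump inside a
  -- cell. But two points over the same base `y`, one at or below and one at or above height `t`,
  -- are near points of the window and so lie in the dilate. The fibres of the dilate are intervals,
  -- hence the height `t` is admissible too.
  have hq₁ := hnear (Fin.snoc (α := fun _ => ℝ) (r⁻¹ • z₁) (lo m (r⁻¹ • z₁)))
    (snoc_mem_region.2 ⟨hy₁, le_rfl, hΔ.le m m.lt_succ_self _ hy₁⟩)
    (Fin.snoc (α := fun _ => ℝ) y (min (lo m (r⁻¹ • z₁)) t)) (2 / r) (fun j => by
      refine Fin.lastCases ?_ (fun j => ?_) j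
      · rw [Fin.snoc_last, Fin.snoc_last]
        rcases min_cases (lo m (r⁻¹ • z₁)) t with h | h <;> rw [h.1, abs_le] <;>
          constructor <;> linarith
      · rw [Fin.snoc_castSucc, Fin.snoc_castSucc]; exact hcell z₁ hz₁ j) hc
  have hq₂ := hnear (Fin.snoc (α := fun _ => ℝ) (r⁻¹ • z₂) (up m (r⁻¹ • z₂)))
    (snoc_mem_region.2 ⟨hy₂, hΔ.le m m.lt_succ_self _ hy₂, le_rfl⟩)
    (Fin.snoc (α := fun _ => ℝ) y (max (up m (r⁻¹ • z₂)) t)) (2 / r) (fun j => by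
      refine Fin.lastCases ?_ (fun j => ?_) j
      · rw [Fin.snoc_last, Fin.snoc_last]
        rcases max_cases (up m (r⁻¹ • z₂)) t with h | h <;> rw [h.1, abs_le] <;>
          constructor <;> linarith
      · rw [Fin.snoc_castSucc, Fin.snoc_castSucc]; exact hcell z₂ hz₂ j) hc
  have hsm : ∀ c : ℝ, μ⁻¹ • (Fin.snoc (α := fun _ => ℝ) y c : Fin (m + 1) → ℝ)
      = Fin.snoc (α := fun _ => ℝ) (μ⁻¹ • y) (μ⁻¹ * c) := by
    intro c; ext j
    refine Fin.lastCases ?_ (fun j => ?_) j <;> simp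
  rw [hsm, snoc_mem_region] at hq₁ hq₂
  rw [mem_smul_set_iff_inv_smul_mem₀ hμ.ne']
  have e : (μ⁻¹ • r⁻¹ • latticePoint i).ofLp
      = Fin.snoc (α := fun _ => ℝ) (μ⁻¹ • y) (μ⁻¹ * t) := by
    ext j
    refine Fin.lastCases ?_ (fun j => ?_) j
    · simp [latticePoint, ht]
    · simp only [latticePoint, hy, hi', firstCoords, Fin.snoc_castSucc]; rfl
  change (μ⁻¹ • r⁻¹ • latticePoint i).ofLp ∈ region lo up (m + 1)
  rw [e, snoc_mem_region]
  have hμ' := (inv_pos.2 hμ).le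
  exact ⟨hq₁.1, hq₁.2.1.trans (mul_le_mul_of_nonneg_left (min_le_right _ _) hμ'),
    (mul_le_mul_of_nonneg_left (le_max_right _ _) hμ').trans hq₂.2.2⟩

end Window

/-! ### The rescaled weight on a neighbourhood of the window -/

section Weight

variable {n : ℕ}

theorem ae_comp_smul {a : ℝ} (ha : a ≠ 0) {p : EuclideanSpace ℝ (Fin n) → Prop}
    (hp : ∀ᵐ w, p w) : ∀ᵐ u, p (a • u) := by
  rw [ae_iff] at hp ⊢
  have := Measure.addHaar_preimage_smul (volume : Measure (EuclideanSpace ℝ (Fin n))) ha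
    {w | ¬ p w}
  rw [hp, mul_zero] at this
  exact this

variable {Δ : Set (EuclideanSpace ℝ (Fin n))} {α ε : ℝ} {κ : ℕ} {L : ℝ → ℝ}
  {g gstar : EuclideanSpace ℝ (Fin n) → ℝ}

theorem WeightAssumption.eventually_ne_zero (hg : WeightAssumption Δ α κ L g gstar ε) :
    ∀ᶠ r : ℝ in atTop, g (r • oneVec n) ≠ 0 := by
  filter_upwards [hg.diverges.eventually_gt_atTop 0] with r hr h0
  simp [h0] at hr

/-- The ratio telescopes along the scales `r, c r, c² r, …`, each factor tending to `gstar (c •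
oneVec n)`. -/
theorem WeightAssumption.tendsto_pow (hg : WeightAssumption Δ α κ L g gstar ε) {c : ℝ}
    (hc : 0 < c) (hmem : c • oneVec n ∈ (1 + ε) • Δ) (m : ℕ) :
    Tendsto (fun r : ℝ => g ((c ^ m * r) • oneVec n) / g (r • oneVec n)) atTop
      (𝓝 (gstar (c • oneVec n) ^ m)) := by
  induction m with
  | zero =>
    refine tendsto_const_nhds.congr' ?_
    filter_upwards [hg.eventually_ne_zero] with r hr
    simp [hr]
  | succ m ih =>
    have h1 := (hg.uniform.tendsto_at hmem).comp
      ((tendsto_const_mul_atTop_of_pos (pow_pos hc m)).2 tendsto_id)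
    have h2 := ih.mul h1
    rw [← pow_succ] at h2
    refine h2.congr' ?_
    have h3 := ((tendsto_const_mul_atTop_of_pos (pow_pos hc m)).2
      (tendsto_id (α := ℝ) (x := atTop))).eventually hg.eventually_ne_zero
    filter_upwards [h3] with r hr
    simp only [Function.comp, id, smul_smul] at hr ⊢
    rw [show c ^ (m + 1) * r = c ^ m * r * c by ring]
    field_simp

/-- The uniform limit of the rescaled weight extends to a dilate of the window which is a
neighbourhood of the window. -/
theorem WeightAssumption.exists_dilate (hg : WeightAssumption Δ α κ L g gstar ε)
    (hΔ : IsCompact Δ) (h0 : (0 : EuclideanSpace ℝ (Fin n)) ∈ interior Δ) :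
    ∃ μ : ℝ, 0 < μ ∧ ∃ G : EuclideanSpace ℝ (Fin n) → ℝ, Δ ⊆ interior (μ • Δ) ∧
      TendstoUniformlyOn (fun (r : ℝ) u => g (r • u) / g (r • oneVec n)) G atTop (μ • Δ) ∧
      (∃ C : ℝ, ∀ u ∈ μ • Δ, |G u| ≤ C) ∧
      ∀ᵐ u ∂(volume.restrict (μ • Δ)), ContinuousWithinAt G (μ • Δ) u := by
  have hε := hg.eps_pos
  rcases hg.nondegenerate with hsub | ⟨c, hc0, hc1, hmem, hne⟩
  · exact ⟨1 + ε, by linarith, gstar, hsub, hg.uniform, hg.bounded, hg.ae_continuous⟩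
  obtain ⟨δ, hδ, hball⟩ := Metric.isOpen_iff.1 isOpen_interior 0 h0
  obtain ⟨R, hR⟩ := hΔ.isBounded.exists_norm_le
  have hR' : 0 < |R| + 1 := by positivity
  -- With this `m` the dilate of the inner ball of radius `δ` by `(1 + ε) / c ^ m` has radius above
  -- `|R| + 1`, so it contains the window.
  obtain ⟨m, hm⟩ := exists_pow_lt_of_lt_one (show 0 < (1 + ε) * δ / (|R| + 1) by positivity) hc1
  set a := c ^ m with ha
  have ha0 : 0 < a := pow_pos hc0 m
  set μ := (1 + ε) / a with hμ
  have hμ0 : 0 < μ := by positivity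
  set A := gstar (c • oneVec n) ^ m with hA
  have hA0 : A ≠ 0 := pow_ne_zero _ hne
  have hmaps : ∀ u ∈ μ • Δ, a • u ∈ (1 + ε) • Δ := by
    rintro _ ⟨v, hv, rfl⟩
    refine ⟨v, hv, ?_⟩
    simp only [smul_smul, hμ]
    congr 1; field_simp
  obtain ⟨C, hC⟩ := hg.bounded
  have hlim : Tendsto (fun r : ℝ => g (r • oneVec n) / g ((a⁻¹ * r) • oneVec n)) atTop (𝓝 A) := by
    have := (hg.tendsto_pow hc0 hmem m).comp
      ((tendsto_const_mul_atTop_of_pos (inv_pos.2 ha0)).2 tendsto_id)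
    refine this.congr fun r => ?_
    simp only [Function.comp, id]
    rw [← ha, mul_inv_cancel_left₀ ha0.ne']
  have hlim' : Tendsto (fun r : ℝ => g ((a⁻¹ * r) • oneVec n) / g (r • oneVec n)) atTop
      (𝓝 A⁻¹) := by
    refine (hlim.inv₀ hA0).congr fun r => ?_
    rw [inv_div]
  have htop : Tendsto (fun r : ℝ => a⁻¹ * r) atTop atTop :=
    (tendsto_const_mul_atTop_of_pos (inv_pos.2 ha0)).2 tendsto_id
  -- Factor `g (r u) / g (r 1)` through the larger scale `r / a`: the first factor is the given
  -- ratio at scale `r / a` and point `a u`, the second tends to `A⁻¹`.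
  refine ⟨μ, hμ0, fun u => gstar (a • u) * A⁻¹, ?_, ?_, ⟨C * |A⁻¹|, fun u hu => ?_⟩, ?_⟩
  · intro u hu
    rw [interior_smul₀ hμ0.ne', mem_smul_set_iff_inv_smul_mem₀ hμ0.ne']
    apply hball
    rw [mem_ball_zero_iff, norm_smul, Real.norm_eq_abs, abs_of_pos (inv_pos.2 hμ0), hμ, inv_div]
    rw [lt_div_iff₀ hR'] at hm
    have h1 : ‖u‖ ≤ |R| + 1 := (hR u hu).trans (by linarith [le_abs_self R])
    rw [div_mul_eq_mul_div, div_lt_iff₀ (by positivity)]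
    calc a * ‖u‖ ≤ a * (|R| + 1) := by gcongr
      _ < δ * (1 + ε) := by linarith
  · rw [Metric.tendstoUniformlyOn_iff]
    intro e he
    have hunif := Metric.tendstoUniformlyOn_iff.1 hg.uniform (e / (2 * (|A⁻¹| + 1)))
      (by positivity)
    have hC0 : 0 < |C| + 1 := by positivity
    have hb1 := Metric.tendsto_nhds.1 hlim' 1 one_pos
    have hb2 := Metric.tendsto_nhds.1 hlim' (e / (2 * (|C| + 1))) (by positivity)
    filter_upwards [htop.eventually hunif, hb1, hb2, htop.eventually hg.eventually_ne_zero]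
      with r hr1 hr2 hr3 hr4 u hu
    have h1 := hr1 (a • u) (hmaps u hu)
    rw [smul_smul, mul_comm a⁻¹ r, inv_mul_cancel_right₀ ha0.ne', mul_comm r] at h1
    set b := g ((a⁻¹ * r) • oneVec n) / g (r • oneVec n) with hb
    set f := g (r • u) / g ((a⁻¹ * r) • oneVec n) with hf
    have e1 : g (r • u) / g (r • oneVec n) = f * b := by
      rw [hf, hb, div_mul_div_cancel₀ hr4]
    rw [Real.dist_eq] at h1 hr2 hr3 ⊢
    have hbb : |b| ≤ |A⁻¹| + 1 := by
      have := abs_sub_abs_le_abs_sub b A⁻¹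
      linarith
    have hCu := (hC _ (hmaps u hu)).trans (le_abs_self C)
    rw [e1]
    calc |gstar (a • u) * A⁻¹ - f * b|
        = |(gstar (a • u) - f) * b - gstar (a • u) * (b - A⁻¹)| := by ring_nf
      _ ≤ |gstar (a • u) - f| * |b| + |gstar (a • u)| * |b - A⁻¹| := by
          rw [← abs_mul, ← abs_mul]; exact abs_sub _ _
      _ ≤ |gstar (a • u) - f| * (|A⁻¹| + 1) + (|C| + 1) * |b - A⁻¹| := by
          gcongr; linarith
      _ < e / (2 * (|A⁻¹| + 1)) * (|A⁻¹| + 1) + (|C| + 1) * (e / (2 * (|C| + 1))) := by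
          gcongr
      _ = e := by field_simp; ring
  · rw [abs_mul]
    exact mul_le_mul_of_nonneg_right (hC _ (hmaps u hu)) (abs_nonneg _)
  · have hmeas : ∀ b : ℝ, MeasurableSet (b • Δ) := fun b => (hΔ.smul b).measurableSet
    have h1 := (ae_restrict_iff' (hmeas _)).1 hg.ae_continuous
    rw [ae_restrict_iff' (hmeas _)]
    filter_upwards [ae_comp_smul ha0.ne' h1] with u hu hmem
    have h2 := hu (hmaps u hmem)
    have h3 : ContinuousWithinAt (fun u => gstar (a • u)) (μ • Δ) u :=
      ContinuousWithinAt.comp (g := gstar) (f := fun u => a • u) h2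
        (continuous_const_smul a).continuousWithinAt hmaps
    exact h3.mul_const _

theorem WeightAssumption.exists_eventually_abs_le (hg : WeightAssumption Δ α κ L g gstar ε)
    {D : Set (EuclideanSpace ℝ (Fin n))} {G : EuclideanSpace ℝ (Fin n) → ℝ}
    (hu : TendstoUniformlyOn (fun (r : ℝ) u => g (r • u) / g (r • oneVec n)) G atTop D)
    (hb : ∃ C : ℝ, ∀ u ∈ D, |G u| ≤ C) :
    ∃ C > 0, ∀ᶠ r : ℝ in atTop, ∀ u ∈ D, |g (r • u)| ≤ C * |g (r • oneVec n)| := by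
  obtain ⟨C, hC⟩ := hb
  refine ⟨|C| + 1, by positivity, ?_⟩
  filter_upwards [Metric.tendstoUniformlyOn_iff.1 hu 1 one_pos, hg.eventually_ne_zero]
    with r h1 h2 u hu
  have h3 := h1 u hu
  rw [dist_comm, Real.dist_eq] at h3
  have h4 := abs_sub_abs_le_abs_sub (g (r • u) / g (r • oneVec n)) (G u)
  have h5 := hC u hu
  have h6 := le_abs_self C
  rw [← div_le_iff₀ (abs_pos.2 h2), ← abs_div]
  linarith

/-- A single large scale suffices: since the origin is interior, the scaled dilate swallows any
given ball, and `g` is bounded there. This gives finite second moments for every `r`, not only for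
large ones. -/
theorem WeightAssumption.exists_abs_le_of_norm_le (hg : WeightAssumption Δ α κ L g gstar ε)
    (h0 : (0 : EuclideanSpace ℝ (Fin n)) ∈ interior Δ) (R : ℝ) :
    ∃ C, ∀ x : EuclideanSpace ℝ (Fin n), ‖x‖ ≤ R → |g x| ≤ C := by
  have hε := hg.eps_pos
  have h1ε : 0 < 1 + ε := by linarith
  obtain ⟨C, -, hC⟩ := hg.exists_eventually_abs_le hg.uniform hg.bounded
  obtain ⟨δ, hδ, hball⟩ := Metric.isOpen_iff.1 isOpen_interior 0 h0
  obtain ⟨r, hr, hr0, hrR⟩ := (hC.and ((eventually_gt_atTop 0).and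
    (eventually_gt_atTop (R / ((1 + ε) * δ))))).exists
  refine ⟨C * |g (r • oneVec n)|, fun x hx => ?_⟩
  have hmem : r⁻¹ • x ∈ (1 + ε) • Δ := by
    rw [mem_smul_set_iff_inv_smul_mem₀ h1ε.ne']
    apply interior_subset
    apply hball
    rw [mem_ball_zero_iff, norm_smul, norm_smul, Real.norm_eq_abs, Real.norm_eq_abs,
      abs_of_pos (inv_pos.2 h1ε), abs_of_pos (inv_pos.2 hr0), ← mul_assoc, ← mul_inv,
      inv_mul_lt_iff₀ (by positivity)]
    rw [div_lt_iff₀ (by positivity)] at hrR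
    calc ‖x‖ ≤ R := hx
      _ < _ := by linarith
  have := hr _ hmem
  rwa [smul_inv_smul₀ hr0.ne'] at this

end Weight

/-! ### Second moments of integrals of random fields -/

section SecondMoment

variable {Ω X : Type*} [MeasurableSpace Ω] [MeasurableSpace X] {P : Measure Ω} {μ : Measure X}

theorem integrable_prod_of_bounded [SFinite P] [SFinite μ] {F : X × Ω → ℝ} (hF : Measurable F)
    (hint : ∀ x, Integrable (fun ω => F (x, ω)) P) {C : ℝ} (hC : ∀ x, ∫ ω, ‖F (x, ω)‖ ∂P ≤ C)
    {K : Set X} (hK : MeasurableSet K) (hμK : μ K < ∞) (h0 : ∀ x ∉ K, ∀ ω, F (x, ω) = 0) :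
    Integrable F (μ.prod P) := by
  rw [integrable_prod_iff hF.aestronglyMeasurable]
  refine ⟨ae_of_all _ hint, ?_⟩
  have hb : Integrable (K.indicator fun _ => C) μ :=
    (integrable_indicator_iff hK).2 (integrableOn_const hμK.ne)
  refine hb.mono' (hF.norm.stronglyMeasurable.integral_prod_right').aestronglyMeasurable
    (ae_of_all _ fun x => ?_)
  rw [Real.norm_of_nonneg (integral_nonneg fun _ => norm_nonneg _)]
  by_cases hx : x ∈ K
  · rw [indicator_of_mem hx]; exact hC x
  · rw [indicator_of_notMem hx]; simp [h0 x hx]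

/-- Second moment of the integral of a random field of bounded second moment with support of
finite measure. -/
theorem secondMoment_integral [IsProbabilityMeasure P] [SFinite μ] {V : X → Ω → ℝ}
    (hV : Measurable (Function.uncurry V)) (hL : ∀ x, MemLp (V x) 2 P) {C : ℝ}
    (hC : ∀ x, ∫ ω, V x ω ^ 2 ∂P ≤ C) {K : Set X} (hK : MeasurableSet K) (hμK : μ K < ∞)
    (h0 : ∀ x ∉ K, ∀ ω, V x ω = 0) :
    (∀ᵐ ω ∂P, Integrable (fun x => V x ω) μ) ∧
    MemLp (fun ω => ∫ x, V x ω ∂μ) 2 P ∧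
    ∫ ω, (∫ x, V x ω ∂μ) ^ 2 ∂P = ∫ z, (∫ ω, V z.1 ω * V z.2 ω ∂P) ∂(μ.prod μ) := by
  have i1 : Integrable (Function.uncurry V) (μ.prod P) := by
    refine integrable_prod_of_bounded hV (fun x => (hL x).integrable one_le_two) (C := 1 + C)
      (fun x => ?_) hK hμK h0
    have hsq : Integrable (fun ω => V x ω ^ 2) P := (hL x).integrable_sq
    calc ∫ ω, ‖Function.uncurry V (x, ω)‖ ∂P ≤ ∫ ω, (1 + V x ω ^ 2) ∂P := by
          refine integral_mono ((hL x).integrable one_le_two).norm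
            ((integrable_const 1).add hsq) fun ω => ?_
          simp only [Function.uncurry, Real.norm_eq_abs]
          nlinarith [sq_abs (V x ω), sq_nonneg (|V x ω| - 1)]
      _ = 1 + ∫ ω, V x ω ^ 2 ∂P := by
          rw [integral_add (integrable_const 1) hsq]; simp
      _ ≤ 1 + C := by linarith [hC x]
  have i2 : Integrable (fun z : (X × X) × Ω => V z.1.1 z.2 * V z.1.2 z.2)
      ((μ.prod μ).prod P) := by
    have hm : Measurable (fun z : (X × X) × Ω => V z.1.1 z.2 * V z.1.2 z.2) := by
      have h1 : Measurable (fun z : (X × X) × Ω => V z.1.1 z.2) :=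
        hV.comp (f := fun z : (X × X) × Ω => (z.1.1, z.2)) (by fun_prop)
      have h2 : Measurable (fun z : (X × X) × Ω => V z.1.2 z.2) :=
        hV.comp (f := fun z : (X × X) × Ω => (z.1.2, z.2)) (by fun_prop)
      exact h1.mul h2
    refine integrable_prod_of_bounded hm (fun z => (hL z.1).integrable_mul (hL z.2)) (C := C)
      (fun z => ?_) (hK.prod hK) ?_ ?_
    · have hsq : ∀ x, Integrable (fun ω => V x ω ^ 2 / 2) P := fun x =>
        (hL x).integrable_sq.div_const 2
      calc ∫ ω, ‖V z.1 ω * V z.2 ω‖ ∂P ≤ ∫ ω, (V z.1 ω ^ 2 / 2 + V z.2 ω ^ 2 / 2) ∂P := by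
            refine integral_mono ((hL z.1).integrable_mul (hL z.2)).norm
              ((hsq _).add (hsq _)) fun ω => ?_
            simp only [norm_mul, Real.norm_eq_abs]
            nlinarith [sq_abs (V z.1 ω), sq_abs (V z.2 ω), sq_nonneg (|V z.1 ω| - |V z.2 ω|)]
        _ = (∫ ω, V z.1 ω ^ 2 ∂P) / 2 + (∫ ω, V z.2 ω ^ 2 ∂P) / 2 := by
            rw [integral_add (hsq _) (hsq _), integral_div, integral_div]
        _ ≤ C := by linarith [hC z.1, hC z.2]
    · rw [Measure.prod_prod]; exact ENNReal.mul_lt_top hμK hμK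
    · intro z hz ω
      simp only [mem_prod, not_and_or] at hz
      rcases hz with hz | hz <;> simp [h0 _ hz]
  have e : ∀ ω, (∫ x, V x ω ∂μ) ^ 2 = ∫ z : X × X, V z.1 ω * V z.2 ω ∂(μ.prod μ) := fun ω => by
    rw [sq, ← integral_prod_mul]
  refine ⟨i1.prod_left_ae, ?_, ?_⟩
  · refine (memLp_two_iff_integrable_sq i1.integral_prod_right.aestronglyMeasurable).2 ?_
    simp only [Function.uncurry]
    simp_rw [e]
    exact i2.integral_prod_right
  · simp_rw [e]
    exact (integral_integral_swap (f := fun (z : X × X) ω => V z.1 ω * V z.2 ω) i2).symm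

end SecondMoment

/-! ### Lattice sums as integrals of step functions -/

section Floor

variable {n : ℕ}

/-- The coordinatewise integer part. -/
def floorVec (x : EuclideanSpace ℝ (Fin n)) : Fin n → ℤ := fun j => ⌊x j⌋

theorem measurable_floorVec : Measurable (floorVec (n := n)) :=
  measurable_pi_lambda _ fun j => Int.measurable_floor.comp
    ((measurable_pi_apply j).comp (PiLp.volume_preserving_ofLp (Fin n)).measurable)

theorem measurable_latticePoint : Measurable (latticePoint (n := n)) :=
  (PiLp.volume_preserving_toLp (Fin n)).measurable.comp
    (measurable_pi_lambda _ fun j => (measurable_of_countable _).comp (measurable_pi_apply j))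

theorem norm_latticePoint_floorVec_sub_le (x : EuclideanSpace ℝ (Fin n)) :
    ‖latticePoint (floorVec x) - x‖ ≤ n := by
  have := EuclideanSpace.norm_le_card_mul (c := 1) (x := latticePoint (floorVec x) - x)
    fun j => by
      have h1 := Int.floor_le (x j)
      have h2 := Int.lt_floor_add_one (x j)
      simp only [latticePoint, floorVec, PiLp.sub_apply]
      rw [abs_le]; constructor <;> linarith
  simpa using this

theorem volume_floorVec_preimage (i : Fin n → ℤ) :
    volume (floorVec ⁻¹' {i} : Set (EuclideanSpace ℝ (Fin n))) = 1 := by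
  have e : (floorVec ⁻¹' {i} : Set (EuclideanSpace ℝ (Fin n)))
      = WithLp.ofLp ⁻¹' (Set.univ.pi fun j => Ico (i j : ℝ) (i j + 1)) := by
    ext x
    simp only [mem_preimage, mem_singleton_iff, floorVec, funext_iff, Int.floor_eq_iff,
      Set.mem_pi, mem_univ, true_imp_iff, mem_Ico]
  rw [e, (PiLp.volume_preserving_ofLp (Fin n)).measure_preimage
    (MeasurableSet.univ_pi fun j => measurableSet_Ico).nullMeasurableSet, Real.volume_pi_Ico]
  simp

-- The level sets of the integer part are disjoint cells of volume one.
open Classical in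
theorem integral_floorVec (Q : Finset (Fin n → ℤ)) (F : (Fin n → ℤ) → ℝ) :
    ∫ x : EuclideanSpace ℝ (Fin n), (if floorVec x ∈ Q then F (floorVec x) else 0)
      = ∑ i ∈ Q, F i := by
  have e : ∀ x : EuclideanSpace ℝ (Fin n), (if floorVec x ∈ Q then F (floorVec x) else 0)
      = ∑ i ∈ Q, (floorVec ⁻¹' {i}).indicator (fun _ => F i) x := by
    intro x
    simp [indicator_apply]
  have hms : ∀ i, MeasurableSet (floorVec ⁻¹' {i} : Set (EuclideanSpace ℝ (Fin n))) := fun i =>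
    measurable_floorVec (measurableSet_singleton i)
  simp_rw [e]
  rw [integral_finsetSum]
  · refine Finset.sum_congr rfl fun i _ => ?_
    rw [integral_indicator_const _ (hms i), Measure.real, volume_floorVec_preimage]
    simp
  · intro i _
    exact (integrable_indicator_iff (hms i)).2
      (integrableOn_const (by rw [volume_floorVec_preimage]; exact ENNReal.one_ne_top))

end Floor

/-! ### Integrability of the dominating kernel -/

section RieszKernel

variable {n : ℕ}

/-- This is the integrand of a convolution of two integrable functions; the singular one is
integrable because `γ < n`. Truncating at `2 R` loses nothing for pairs in the ball of radius `R`.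
-/
theorem integrable_indicator_mul_norm_sub_rpow (hn : 1 ≤ n) {γ : ℝ} (hγ : γ < n) (R : ℝ) :
    Integrable (fun z : EuclideanSpace ℝ (Fin n) × EuclideanSpace ℝ (Fin n) =>
      (Metric.closedBall (0 : EuclideanSpace ℝ (Fin n)) R).indicator (fun _ => (1 : ℝ)) z.2 *
      (Metric.closedBall (0 : EuclideanSpace ℝ (Fin n)) (2 * R)).indicator
        (fun w => ‖w‖ ^ (-γ)) (z.1 - z.2)) (volume.prod volume) := by
  have h1 : Integrable ((Metric.closedBall (0 : EuclideanSpace ℝ (Fin n)) R).indicator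
      (fun _ => (1 : ℝ))) :=
    (integrable_indicator_iff measurableSet_closedBall).2
      (integrableOn_const measure_closedBall_lt_top.ne)
  have h2 : Integrable ((Metric.closedBall (0 : EuclideanSpace ℝ (Fin n)) (2 * R)).indicator
      (fun w => ‖w‖ ^ (-γ))) := by
    rw [integrable_indicator_iff measurableSet_closedBall]
    have hm : Measurable fun w : EuclideanSpace ℝ (Fin n) => ‖w‖ ^ (-γ) :=
      measurable_norm.pow_const _
    have := locallyIntegrable_of_norm_le_rpow (μ := (volume : Measure (EuclideanSpace ℝ (Fin n))))
      (f := fun w => ‖w‖ ^ (-γ)) (C := 1) (α := γ) (by simpa using hn) (by simpa using hγ)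
      (ae_of_all _ fun w => by
        rw [one_mul, Real.norm_of_nonneg (Real.rpow_nonneg (norm_nonneg _) _)])
      hm.aestronglyMeasurable
    exact this.integrableOn_isCompact (isCompact_closedBall _ _)
  exact h1.convolution_integrand (ContinuousLinearMap.mul ℝ ℝ) h2

end RieszKernel

/-! ### The two functionals as integrals of one family of fields -/

section Sampling

variable {n : ℕ} {Ω : Type*}
  {ξ : EuclideanSpace ℝ (Fin n) → Ω → ℝ} {B : ℝ → ℝ}
  {lo up : (k : ℕ) → (Fin k → ℝ) → ℝ} {κ : ℕ} {g : EuclideanSpace ℝ (Fin n) → ℝ}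

/-- The point itself, or the lattice point of its coordinatewise integer parts. -/
def samplePoint (s : Bool) (x : EuclideanSpace ℝ (Fin n)) : EuclideanSpace ℝ (Fin n) :=
  if s then latticePoint (floorVec x) else x

open Classical in
/-- The weight of the integral functional, or of the additive functional regarded as the integral
of a step function. -/
def sampleWeight (lo up : (k : ℕ) → (Fin k → ℝ) → ℝ) (g : EuclideanSpace ℝ (Fin n) → ℝ)
    (s : Bool) (r : ℝ) (x : EuclideanSpace ℝ (Fin n)) : ℝ :=
  if s then if floorVec x ∈ latticeSet lo up r n then g (latticePoint (floorVec x)) else 0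
  else (r • window lo up n).indicator g x

/-- The sign of the two functionals in their difference. -/
def sampleSign (s : Bool) : ℝ := if s then -1 else 1

/-- The field whose integral is one of the two functionals. -/
def sampleField (lo up : (k : ℕ) → (Fin k → ℝ) → ℝ) (κ : ℕ) (g : EuclideanSpace ℝ (Fin n) → ℝ)
    (ξ : EuclideanSpace ℝ (Fin n) → Ω → ℝ) (r : ℝ) (s : Bool)
    (x : EuclideanSpace ℝ (Fin n)) (ω : Ω) : ℝ :=
  sampleWeight lo up g s r x * hermiteFun κ (ξ (samplePoint s x) ω)

theorem measurable_samplePoint (s : Bool) : Measurable (samplePoint (n := n) s) := by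
  cases s
  · exact measurable_id
  · exact measurable_latticePoint.comp measurable_floorVec

theorem norm_samplePoint_sub_le (s : Bool) (x : EuclideanSpace ℝ (Fin n)) :
    ‖samplePoint s x - x‖ ≤ n := by
  cases s
  · simp [samplePoint]
  · exact norm_latticePoint_floorVec_sub_le x

theorem measurable_sampleWeight (hΔ : IsWindow n lo up) (hg : Measurable g) (s : Bool) (r : ℝ) :
    Measurable (sampleWeight lo up g s r) := by
  cases s
  · exact hg.indicator (hΔ.compact.smul r).measurableSet
  · have e : sampleWeight lo up g true r = fun x => if floorVec x ∈ latticeSet lo up r n then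
        g (latticePoint (floorVec x)) else 0 := by ext x; simp [sampleWeight]
    rw [e]
    refine Measurable.ite ?_ (hg.comp (measurable_latticePoint.comp measurable_floorVec))
      measurable_const
    exact measurable_floorVec (Finset.measurableSet _)

theorem integral_sampleField_true (r : ℝ) (ω : Ω) :
    ∫ x, sampleField lo up κ g ξ r true x ω = additiveFunctional lo up κ g ξ r ω := by
  classical
  rw [additiveFunctional, ← integral_floorVec]
  congr 1; ext x
  simp only [sampleField, sampleWeight, samplePoint, if_true]
  split_ifs <;> simp

theorem sampleField_false (r : ℝ) (ω : Ω) :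
    (fun x => sampleField lo up κ g ξ r false x ω)
      = (r • window lo up n).indicator fun x => g x * hermiteFun κ (ξ x ω) := by
  ext x
  simp only [sampleField, sampleWeight, samplePoint, Bool.false_eq_true, if_false]
  by_cases hx : x ∈ r • window lo up n
  · rw [indicator_of_mem hx, indicator_of_mem hx]
  · rw [indicator_of_notMem hx, indicator_of_notMem hx, zero_mul]

variable [MeasurableSpace Ω] {P : Measure Ω}

theorem measurable_sampleField (hΔ : IsWindow n lo up) (hg : Measurable g)
    (hξ : Measurable (Function.uncurry ξ)) (r : ℝ) (s : Bool) :
    Measurable (Function.uncurry (sampleField lo up κ g ξ r s)) := by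
  have h1 : Measurable fun z : EuclideanSpace ℝ (Fin n) × Ω => ξ (samplePoint s z.1) z.2 :=
    hξ.comp (((measurable_samplePoint s).comp measurable_fst).prodMk measurable_snd)
  exact ((measurable_sampleWeight hΔ hg s r).comp measurable_fst).mul
    ((continuous_hermiteFun κ).measurable.comp h1)

/-- For a fixed dilation the weights are bounded with bounded support. -/
theorem exists_sampleWeight_bound (hΔ : IsWindow n lo up)
    (hg : ∀ R, ∃ C, ∀ x : EuclideanSpace ℝ (Fin n), ‖x‖ ≤ R → |g x| ≤ C) (r : ℝ) :
    ∃ C R : ℝ, ∀ s x, |sampleWeight lo up g s r x| ≤ C ∧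
      (x ∉ Metric.closedBall (0 : EuclideanSpace ℝ (Fin n)) R →
        sampleWeight lo up g s r x = 0) := by
  obtain ⟨R₁, hR₁⟩ := (hΔ.compact.smul r).isBounded.exists_norm_le
  obtain ⟨C₁, hC₁⟩ := hg R₁
  obtain ⟨C₂, hC₂⟩ := ((latticeSet lo up r n).image fun i => |g (latticePoint i)|).exists_le
  obtain ⟨R₂, hR₂⟩ := ((latticeSet lo up r n).image fun i => ‖latticePoint i‖).exists_le
  refine ⟨max 0 (max C₁ C₂), max R₁ (R₂ + n), fun s x => ?_⟩
  have hC0 : 0 ≤ max 0 (max C₁ C₂) := le_max_left _ _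
  rw [mem_closedBall_zero_iff, not_le]
  cases s
  · simp only [sampleWeight, Bool.false_eq_true, if_false]
    by_cases hx : x ∈ r • window lo up n
    · rw [indicator_of_mem hx]
      refine ⟨(hC₁ x (hR₁ x hx)).trans (le_max_of_le_right (le_max_left _ _)), fun h => ?_⟩
      exact absurd ((hR₁ x hx).trans (le_max_left _ _)) (not_le.2 h)
    · rw [indicator_of_notMem hx]; simp
  · simp only [sampleWeight, if_true]
    split_ifs with hx
    · refine ⟨(hC₂ _ (Finset.mem_image_of_mem _ hx)).trans
        (le_max_of_le_right (le_max_right _ _)), fun h => ?_⟩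
      have h1 := hR₂ _ (Finset.mem_image_of_mem _ hx)
      have h2 := norm_latticePoint_floorVec_sub_le x
      have h3 := norm_sub_norm_le x (latticePoint (floorVec x))
      rw [norm_sub_rev] at h3
      have h4 := le_max_right R₁ (R₂ + n)
      exact absurd (show ‖x‖ ≤ max R₁ (R₂ + n) by linarith) (not_le.2 h)
    · simp

theorem memLp_sampleField (hξ : IsHomogeneousIsotropicGaussianField P ξ B) (h0 : B 0 = 1)
    (r : ℝ) (s : Bool) (x : EuclideanSpace ℝ (Fin n)) :
    MemLp (sampleField lo up κ g ξ r s x) 2 P :=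
  (hξ.memLp_hermiteFun h0 κ _).const_mul _

variable [IsProbabilityMeasure P]

theorem integral_sampleField_mul (hξ : IsHomogeneousIsotropicGaussianField P ξ B) (h0 : B 0 = 1)
    (r : ℝ) (s t : Bool) (x y : EuclideanSpace ℝ (Fin n)) :
    ∫ ω, sampleField lo up κ g ξ r s x ω * sampleField lo up κ g ξ r t y ω ∂P
      = sampleWeight lo up g s r x * sampleWeight lo up g t r y *
        (B ‖samplePoint s x - samplePoint t y‖ ^ κ * κ.factorial) := by
  rw [← hξ.integral_hermiteFun_mul h0, ← integral_const_mul]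
  congr 1; ext ω
  simp only [sampleField]; ring

/-- The field whose integral is the difference of the two functionals. -/
def diffField (lo up : (k : ℕ) → (Fin k → ℝ) → ℝ) (κ : ℕ) (g : EuclideanSpace ℝ (Fin n) → ℝ)
    (ξ : EuclideanSpace ℝ (Fin n) → Ω → ℝ) (r : ℝ) (x : EuclideanSpace ℝ (Fin n)) (ω : Ω) : ℝ :=
  ∑ s, sampleSign s * sampleField lo up κ g ξ r s x ω

theorem integral_diffField_mul (hξ : IsHomogeneousIsotropicGaussianField P ξ B) (h0 : B 0 = 1)
    (r : ℝ) (x y : EuclideanSpace ℝ (Fin n)) :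
    ∫ ω, diffField lo up κ g ξ r x ω * diffField lo up κ g ξ r y ω ∂P
      = ∑ s, ∑ t, sampleSign s * sampleSign t *
        (sampleWeight lo up g s r x * sampleWeight lo up g t r y *
        (B ‖samplePoint s x - samplePoint t y‖ ^ κ * κ.factorial)) := by
  have e : ∀ ω, diffField lo up κ g ξ r x ω * diffField lo up κ g ξ r y ω
      = ∑ s, ∑ t, sampleSign s * sampleSign t *
        (sampleField lo up κ g ξ r s x ω * sampleField lo up κ g ξ r t y ω) := by
    intro ω
    rw [diffField, diffField, Finset.sum_mul_sum]
    exact Finset.sum_congr rfl fun s _ => Finset.sum_congr rfl fun t _ => by ring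
  have hi : ∀ s t, Integrable (fun ω => sampleSign s * sampleSign t *
      (sampleField lo up κ g ξ r s x ω * sampleField lo up κ g ξ r t y ω)) P := fun s t =>
    ((memLp_sampleField hξ h0 r s x).integrable_mul (memLp_sampleField hξ h0 r t y)).const_mul _
  simp_rw [e]
  rw [integral_finsetSum _ fun s _ => integrable_finsetSum _ fun t _ => hi s t]
  refine Finset.sum_congr rfl fun s _ => ?_
  rw [integral_finsetSum _ fun t _ => hi s t]
  refine Finset.sum_congr rfl fun t _ => ?_
  rw [integral_const_mul, integral_sampleField_mul hξ h0]

theorem measurable_diffField (hΔ : IsWindow n lo up) (hg : Measurable g)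
    (hξ : Measurable (Function.uncurry ξ)) (r : ℝ) :
    Measurable (Function.uncurry (diffField lo up κ g ξ r)) := by
  have : Function.uncurry (diffField lo up κ g ξ r)
      = fun z => ∑ s, sampleSign s * Function.uncurry (sampleField lo up κ g ξ r s) z := rfl
  rw [this]
  exact Finset.measurable_sum _ fun s _ => (measurable_sampleField hΔ hg hξ r s).const_mul _

/-- The difference of the two functionals exists, is square integrable, and its second moment is
an integral of the covariances of the difference field. -/
theorem secondMoment_diff (hξ : IsHomogeneousIsotropicGaussianField P ξ B) (h0 : B 0 = 1)
    (hΔ : IsWindow n lo up) (hgm : Measurable g)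
    (hg : ∀ R, ∃ C, ∀ x : EuclideanSpace ℝ (Fin n), ‖x‖ ≤ R → |g x| ≤ C) (r : ℝ) :
    (∀ᵐ ω ∂P, IntegrableOn (fun x => g x * hermiteFun κ (ξ x ω)) (r • window lo up n)) ∧
    MemLp (fun ω => integralFunctional lo up κ g ξ r ω - additiveFunctional lo up κ g ξ r ω)
      2 P ∧
    ∫ ω, (integralFunctional lo up κ g ξ r ω - additiveFunctional lo up κ g ξ r ω) ^ 2 ∂P
      = ∫ z, (∫ ω, diffField lo up κ g ξ r z.1 ω * diffField lo up κ g ξ r z.2 ω ∂P)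
        ∂((volume : Measure (EuclideanSpace ℝ (Fin n))).prod volume) := by
  obtain ⟨C, R, hCR⟩ := exists_sampleWeight_bound hΔ hg r
  have hC0 : 0 ≤ C := (abs_nonneg _).trans (hCR true 0).1
  have hsmul : ∀ s x, ∫ ω, sampleField lo up κ g ξ r s x ω ^ 2 ∂P ≤ C ^ 2 * κ.factorial := by
    intro s x
    simp_rw [sq (sampleField lo up κ g ξ r s x _)]
    rw [integral_sampleField_mul hξ h0]
    simp only [sub_self, norm_zero, h0, one_pow, one_mul, ← sq]
    rw [← sq_abs]
    have := (hCR s x).1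
    gcongr
  have hzero : ∀ s, ∀ x ∉ Metric.closedBall (0 : EuclideanSpace ℝ (Fin n)) R, ∀ ω,
      sampleField lo up κ g ξ r s x ω = 0 := fun s x hx ω => by
    rw [sampleField, (hCR s x).2 hx, zero_mul]
  have hs := fun s => secondMoment_integral (μ := volume)
    (measurable_sampleField (κ := κ) hΔ hgm hξ.measurable r s)
    (memLp_sampleField hξ h0 r s) (hsmul s) measurableSet_closedBall
    (measure_closedBall_lt_top (x := (0 : EuclideanSpace ℝ (Fin n))) (r := R)) (hzero s)
  have hmem : ∀ x, MemLp (diffField lo up κ g ξ r x) 2 P := fun x =>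
    memLp_finsetSum _ fun s _ => (memLp_sampleField hξ h0 r s x).const_mul _
  have hdsq : ∀ x, ∫ ω, diffField lo up κ g ξ r x ω ^ 2 ∂P ≤ 4 * (C ^ 2 * κ.factorial) := by
    intro x
    have hi : ∀ s, Integrable (fun ω => 2 * sampleField lo up κ g ξ r s x ω ^ 2) P := fun s =>
      (memLp_sampleField hξ h0 r s x).integrable_sq.const_mul 2
    calc ∫ ω, diffField lo up κ g ξ r x ω ^ 2 ∂P
        ≤ ∫ ω, (2 * sampleField lo up κ g ξ r true x ω ^ 2
          + 2 * sampleField lo up κ g ξ r false x ω ^ 2) ∂P := by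
          refine integral_mono (hmem x).integrable_sq ((hi true).add (hi false)) fun ω => ?_
          simp only [diffField, Fintype.sum_bool, sampleSign, if_true, Bool.false_eq_true,
            if_false]
          nlinarith [sq_nonneg (sampleField lo up κ g ξ r true x ω
            + sampleField lo up κ g ξ r false x ω)]
      _ = 2 * (∫ ω, sampleField lo up κ g ξ r true x ω ^ 2 ∂P)
          + 2 * ∫ ω, sampleField lo up κ g ξ r false x ω ^ 2 ∂P := by
          rw [integral_add (hi true) (hi false), integral_const_mul, integral_const_mul]
      _ ≤ _ := by linarith [hsmul true x, hsmul false x]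
  obtain ⟨-, hd2, hd3⟩ := secondMoment_integral (μ := volume)
    (measurable_diffField (κ := κ) hΔ hgm hξ.measurable r) hmem hdsq measurableSet_closedBall
    (measure_closedBall_lt_top (x := (0 : EuclideanSpace ℝ (Fin n))) (r := R))
    (fun x hx ω => by simp [diffField, hzero _ x hx ω])
  have hae : (fun ω => ∫ x, diffField lo up κ g ξ r x ω) =ᵐ[P] fun ω =>
      integralFunctional lo up κ g ξ r ω - additiveFunctional lo up κ g ξ r ω := by
    filter_upwards [(hs true).1, (hs false).1] with ω h1 h2
    have e : ∀ x, diffField lo up κ g ξ r x ω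
        = sampleField lo up κ g ξ r false x ω - sampleField lo up κ g ξ r true x ω := fun x => by
      simp only [diffField, Fintype.sum_bool, sampleSign, if_true, Bool.false_eq_true, if_false]
      ring
    simp_rw [e]
    rw [integral_sub h2 h1, integral_sampleField_true, sampleField_false, integralFunctional,
      integral_indicator (hΔ.compact.smul r).measurableSet]
  refine ⟨?_, hd2.ae_eq hae, ?_⟩
  · filter_upwards [(hs false).1] with ω hω
    rw [sampleField_false] at hω
    exact (integrable_indicator_iff (hΔ.compact.smul r).measurableSet).1 hω
  · rw [← hd3]
    exact integral_congr_ae (hae.mono fun ω h => by simp only [h])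

end Sampling

/-! ### Limits and bounds after rescaling -/

section Limit

variable {n : ℕ} {lo up : (k : ℕ) → (Fin k → ℝ) → ℝ} {α ε μ : ℝ} {κ : ℕ} {L : ℝ → ℝ}
  {g gstar G : EuclideanSpace ℝ (Fin n) → ℝ}

theorem norm_inv_smul_samplePoint_sub_le {r : ℝ} (hr : 0 < r) (s : Bool)
    (u : EuclideanSpace ℝ (Fin n)) : ‖r⁻¹ • samplePoint s (r • u) - u‖ ≤ n / r := by
  have h := norm_samplePoint_sub_le s (r • u)
  have e : r⁻¹ • samplePoint s (r • u) - u = r⁻¹ • (samplePoint s (r • u) - r • u) := by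
    rw [smul_sub, inv_smul_smul₀ hr.ne']
  rw [e, norm_smul, Real.norm_eq_abs, abs_of_pos (inv_pos.2 hr), inv_mul_eq_div]
  gcongr

theorem tendsto_inv_smul_samplePoint (s : Bool) (u : EuclideanSpace ℝ (Fin n)) :
    Tendsto (fun r : ℝ => r⁻¹ • samplePoint s (r • u)) atTop (𝓝 u) := by
  rw [tendsto_iff_norm_sub_tendsto_zero]
  refine squeeze_zero' (Eventually.of_forall fun _ => norm_nonneg _) ?_
    (tendsto_const_nhds.div_atTop tendsto_id : Tendsto (fun r : ℝ => (n : ℝ) / r) atTop (𝓝 0))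
  filter_upwards [eventually_gt_atTop 0] with r hr
  exact norm_inv_smul_samplePoint_sub_le hr s u

theorem tendsto_norm_samplePoint_sub (s t : Bool) (u v : EuclideanSpace ℝ (Fin n)) :
    Tendsto (fun r : ℝ => ‖samplePoint s (r • u) - samplePoint t (r • v)‖ / r) atTop
      (𝓝 ‖u - v‖) := by
  refine ((tendsto_inv_smul_samplePoint s u).sub (tendsto_inv_smul_samplePoint t v)).norm.congr' ?_
  filter_upwards [eventually_gt_atTop 0] with r hr
  rw [← smul_sub, norm_smul, Real.norm_eq_abs, abs_of_pos (inv_pos.2 hr), inv_mul_eq_div]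

theorem abs_norm_samplePoint_sub_le {r : ℝ} (hr : 0 < r) (s t : Bool)
    (u v : EuclideanSpace ℝ (Fin n)) :
    |‖samplePoint s (r • u) - samplePoint t (r • v)‖ - r * ‖u - v‖| ≤ 2 * n := by
  have e : r * ‖u - v‖ = ‖r • u - r • v‖ := by
    rw [← smul_sub, norm_smul, Real.norm_eq_abs, abs_of_pos hr]
  rw [e]
  refine (abs_norm_sub_norm_le _ _).trans ?_
  have h1 := norm_samplePoint_sub_le s (r • u)
  have h2 := norm_samplePoint_sub_le t (r • v)
  calc ‖samplePoint s (r • u) - samplePoint t (r • v) - (r • u - r • v)‖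
      = ‖(samplePoint s (r • u) - r • u) - (samplePoint t (r • v) - r • v)‖ := by
        congr 1; abel
    _ ≤ ‖samplePoint s (r • u) - r • u‖ + ‖samplePoint t (r • v) - r • v‖ := norm_sub_le _ _
    _ ≤ 2 * n := by linarith

/-- The rescaled weights of both functionals have the same almost everywhere limit. -/
theorem ae_tendsto_sampleWeight (hΔ : IsWindow n lo up)
    (hsub : window lo up n ⊆ interior (μ • window lo up n))
    (hunif : TendstoUniformlyOn (fun (r : ℝ) u => g (r • u) / g (r • oneVec n)) G atTop
      (μ • window lo up n))
    (hcont : ∀ᵐ u ∂(volume.restrict (μ • window lo up n)),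
      ContinuousWithinAt G (μ • window lo up n) u) :
    ∀ᵐ u, ∀ s, Tendsto (fun r : ℝ => sampleWeight lo up g s r (r • u) / g (r • oneVec n)) atTop
      (𝓝 ((window lo up n).indicator G u)) := by
  rw [ae_restrict_iff' (hΔ.compact.smul μ).measurableSet] at hcont
  filter_upwards [hcont, hΔ.ae_continuousWithinAt] with u hu hu' s
  by_cases hmem : u ∈ window lo up n
  · rw [indicator_of_mem hmem]
    have hmemD := interior_subset (hsub hmem)
    have hev : ∀ᶠ r : ℝ in atTop, r⁻¹ • samplePoint s (r • u) ∈ μ • window lo up n :=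
      (tendsto_inv_smul_samplePoint s u).eventually (mem_interior_iff_mem_nhds.1 (hsub hmem))
    -- Uniform convergence, together with continuity of the limit at `u`, allows evaluation at the
    -- moving sampled points, which stay in the dilate because `u` is interior to it.
    have h1 := hunif.tendstoLocallyUniformlyOn.tendsto_comp (hu hmemD) hmemD
      (tendsto_nhdsWithin_iff.2 ⟨tendsto_inv_smul_samplePoint s u, hev⟩)
    refine h1.congr' ?_
    filter_upwards [eventually_gt_atTop 0] with r hr
    rw [smul_inv_smul₀ hr.ne']
    congr 1
    cases s
    · simp only [sampleWeight, samplePoint, Bool.false_eq_true, if_false]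
      rw [indicator_of_mem (smul_mem_smul_set hmem)]
    · simp only [sampleWeight, samplePoint, if_true]
      exact (if_pos (hΔ.floor_mem_latticeSet hr hmem)).symm
  · rw [indicator_of_notMem hmem]
    refine tendsto_const_nhds.congr' ?_
    cases s
    · filter_upwards [eventually_gt_atTop 0] with r hr
      simp only [sampleWeight, Bool.false_eq_true, if_false]
      rw [indicator_of_notMem, zero_div]
      rwa [smul_mem_smul_set_iff₀ hr.ne']
    · filter_upwards [eventually_floor_notMem_latticeSet hmem hu'] with r hr
      simp only [sampleWeight, if_true]
      rw [if_neg, zero_div]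
      exact hr

/-- The rescaled weights are eventually bounded with a common bounded support. -/
theorem exists_eventually_sampleWeight_bound (hn : 1 ≤ n) (hΔ : IsWindow n lo up) (hμ : 0 < μ)
    (hsub : window lo up n ⊆ interior (μ • window lo up n))
    (hbd : ∃ C > 0, ∀ᶠ r : ℝ in atTop, ∀ u ∈ μ • window lo up n,
      |g (r • u)| ≤ C * |g (r • oneVec n)|) :
    ∃ C > 0, ∃ R > 0, ∀ᶠ r : ℝ in atTop, ∀ s u,
      |sampleWeight lo up g s r (r • u) / g (r • oneVec n)| ≤
        (Metric.closedBall (0 : EuclideanSpace ℝ (Fin n)) R).indicator (fun _ => C) u := by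
  obtain ⟨C, hC, hbd⟩ := hbd
  obtain ⟨R, hR⟩ := (hΔ.compact.smul μ).isBounded.exists_norm_le
  refine ⟨C, hC, |R| + n + 1, by positivity, ?_⟩
  filter_upwards [hbd, hΔ.eventually_latticePoint_mem hn hμ hsub, eventually_ge_atTop 1]
    with r h1 h2 hr1 s u
  have hr0 : 0 < r := by linarith
  -- The weight is evaluated at a sampled point `v` of the dilate, and for `r ≥ 1` this is within
  -- `n` of `u`; hence the radius of the common support.
  have main : ∀ v ∈ μ • window lo up n, ‖v - u‖ ≤ n → |g (r • v) / g (r • oneVec n)| ≤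
      (Metric.closedBall (0 : EuclideanSpace ℝ (Fin n)) (|R| + n + 1)).indicator (fun _ => C) u := by
    intro v hv hvu
    have hu : u ∈ Metric.closedBall (0 : EuclideanSpace ℝ (Fin n)) (|R| + n + 1) := by
      rw [mem_closedBall_zero_iff]
      have h3 := norm_sub_norm_le u v
      rw [norm_sub_rev] at h3
      linarith [hR v hv, le_abs_self R]
    rw [indicator_of_mem hu, abs_div]
    exact div_le_of_le_mul₀ (abs_nonneg _) hC.le (h1 v hv)
  have hnonneg : |(0 : ℝ)| ≤
      (Metric.closedBall (0 : EuclideanSpace ℝ (Fin n)) (|R| + n + 1)).indicator (fun _ => C) u := by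
    rw [abs_zero]; exact indicator_nonneg (fun _ _ => hC.le) _
  cases s
  · simp only [sampleWeight, Bool.false_eq_true, if_false]
    by_cases hu : u ∈ window lo up n
    · rw [indicator_of_mem (smul_mem_smul_set hu)]
      exact main u (interior_subset (hsub hu)) (by simp)
    · rw [indicator_of_notMem (by rwa [smul_mem_smul_set_iff₀ hr0.ne']), zero_div]
      exact hnonneg
  · simp only [sampleWeight, if_true]
    split_ifs with hu
    · have h3 := main _ (h2 _ hu) ((norm_inv_smul_samplePoint_sub_le hr0 true u).trans
        (div_le_self (Nat.cast_nonneg n) hr1))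
      rwa [smul_inv_smul₀ hr0.ne'] at h3
    · rw [zero_div]; exact hnonneg

end Limit

/-! ### The limit theorem by dominated convergence -/

theorem ae_fst_ne_snd {n : ℕ} (hn : 1 ≤ n) :
    ∀ᵐ z ∂(volume : Measure (EuclideanSpace ℝ (Fin n))).prod volume, z.1 ≠ z.2 := by
  have : Nonempty (Fin n) := ⟨⟨0, hn⟩⟩
  have hms : MeasurableSet {z : EuclideanSpace ℝ (Fin n) × EuclideanSpace ℝ (Fin n) |
      z.1 ≠ z.2} := (measurableSet_eq_fun measurable_fst measurable_snd).compl
  rw [Measure.ae_prod_iff_ae_ae hms]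
  refine ae_of_all _ fun x => ?_
  have : ∀ᵐ y : EuclideanSpace ℝ (Fin n), y ≠ x := by
    rw [ae_iff]; simp
  filter_upwards [this] with y hy using hy.symm

theorem theorem5 {n : ℕ} (hn : 2 ≤ n) {Ω : Type*} [MeasurableSpace Ω] (P : Measure Ω)
    [IsProbabilityMeasure P] (ξ : EuclideanSpace ℝ (Fin n) → Ω → ℝ) (B L₀ L : ℝ → ℝ)
    (α : ℝ) (κ : ℕ) (hκ : 1 ≤ κ) (hα : α ∈ Ioo (0 : ℝ) ((n : ℝ) / κ))
    (hξ : IsHomogeneousIsotropicGaussianField P ξ B)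
    (hcov : CovarianceAssumption B α L₀)
    (hspec : SpectralAssumption n B α L₀ L)
    (lo up : (k : ℕ) → (Fin k → ℝ) → ℝ) (hΔ : IsWindow n lo up)
    (g gstar : EuclideanSpace ℝ (Fin n) → ℝ) (ε : ℝ)
    (hg : WeightAssumption (window lo up n) α κ L g gstar ε) :
    (∀ r : ℝ, 0 < r →
      (∀ᵐ ω ∂P, IntegrableOn (fun x => g x * hermiteFun κ (ξ x ω)) (r • window lo up n)) ∧
      MemLp (fun ω => integralFunctional lo up κ g ξ r ω - additiveFunctional lo up κ g ξ r ω)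
        2 P) ∧
    Tendsto (fun r : ℝ =>
      (∫ ω, (integralFunctional lo up κ g ξ r ω - additiveFunctional lo up κ g ξ r ω) ^ 2 ∂P) /
        (r ^ (2 * (n : ℝ) - α * κ) * L r ^ κ * g (r • oneVec n) ^ 2))
      atTop (𝓝 0) := by
  have hn1 : 1 ≤ n := by omega
  have h0 := hcov.at_zero
  have hgb := hg.exists_abs_le_of_norm_le hΔ.zero_mem
  have hsecond := secondMoment_diff (κ := κ) hξ h0 hΔ hg.measurable hgb
  refine ⟨fun r _ => ⟨(hsecond r).1, (hsecond r).2.1⟩, ?_⟩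
  have hκ0 : (0 : ℝ) < κ := by exact_mod_cast hκ
  have hακ : α * κ < n := (lt_div_iff₀ hκ0).1 hα.2
  -- Above `ακ` to absorb slow variation, below `n` for local integrability.
  obtain ⟨γ, hγ1, hγ2⟩ := exists_between hακ
  obtain ⟨μ, hμ, G, hsub, hunif, hGb, hGc⟩ := hg.exists_dilate hΔ.compact hΔ.zero_mem
  have hwlim := ae_tendsto_sampleWeight hΔ hsub hunif hGc
  obtain ⟨C, hC, R, hR, hwb⟩ := exists_eventually_sampleWeight_bound hn1 hΔ hμ hsub
    (hg.exists_eventually_abs_le hunif hGb)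
  have hn0 : (0 : ℝ) < n := by exact_mod_cast hn1
  -- Points in the ball of radius `R` are at most `2 R` apart, and rounding both adds at most `2 n`;
  -- the extra `1` secures `M ≥ 1`.
  obtain ⟨C', hC', r₀, hr₀, hkb⟩ := hcov.exists_normalized_le_rpow hspec.slowlyVarying hspec.equiv
    hκ (fun s hs => hξ.abs_le_one hn1 h0 hs) (M := 2 * R + 2 * n + 1) (c := 2 * n) hγ1
    (by linarith) (by positivity)
  set Φ : ℝ → EuclideanSpace ℝ (Fin n) × EuclideanSpace ℝ (Fin n) → ℝ := fun r z =>
    r ^ (α * κ) / L r ^ κ / g (r • oneVec n) ^ 2 *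
      ∫ ω, diffField lo up κ g ξ r (r • z.1) ω * diffField lo up κ g ξ r (r • z.2) ω ∂P with hΦ
  set term : Bool → Bool → ℝ → EuclideanSpace ℝ (Fin n) × EuclideanSpace ℝ (Fin n) → ℝ :=
    fun s t r z => (sampleWeight lo up g s r (r • z.1) / g (r • oneVec n)) *
      (sampleWeight lo up g t r (r • z.2) / g (r • oneVec n)) *
      (B ‖samplePoint s (r • z.1) - samplePoint t (r • z.2)‖ ^ κ * (r ^ (α * κ) / L r ^ κ))
    with hterm
  have hΦterm : ∀ r z, Φ r z
      = κ.factorial * ∑ s, ∑ t, sampleSign s * sampleSign t * term s t r z := by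
    intro r z
    simp only [hΦ, hterm]
    rw [integral_diffField_mul hξ h0]
    simp only [Finset.mul_sum]
    refine Finset.sum_congr rfl fun s _ => Finset.sum_congr rfl fun t _ => ?_
    ring
  -- The Jacobian `r ^ (2 n)` of the change of variables supplies the missing power of `r` in the
  -- normalisation.
  have hratio : ∀ᶠ r : ℝ in atTop, ∫ z, Φ r z ∂(volume.prod volume)
      = (∫ ω, (integralFunctional lo up κ g ξ r ω - additiveFunctional lo up κ g ξ r ω) ^ 2 ∂P) /
        (r ^ (2 * (n : ℝ) - α * κ) * L r ^ κ * g (r • oneVec n) ^ 2) := by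
    filter_upwards [eventually_gt_atTop 0] with r hr
    rw [(hsecond r).2.2, hΦ]
    simp only
    rw [integral_const_mul]
    have hsc := Measure.integral_comp_smul_of_nonneg
      ((volume : Measure (EuclideanSpace ℝ (Fin n))).prod volume)
      (fun z => ∫ ω, diffField lo up κ g ξ r z.1 ω * diffField lo up κ g ξ r z.2 ω ∂P) r
      (hR := hr.le)
    simp only [Prod.smul_fst, Prod.smul_snd] at hsc
    rw [hsc, Module.finrank_prod, finrank_euclideanSpace, Fintype.card_fin, smul_eq_mul]
    have e : r ^ (2 * (n : ℝ) - α * κ) = r ^ (n + n) / r ^ (α * κ) := by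
      rw [Real.rpow_sub hr, ← Real.rpow_natCast r (n + n)]
      congr 2; push_cast; ring
    have hp : (0 : ℝ) < r ^ (α * κ) := Real.rpow_pos_of_pos hr _
    rw [e]
    generalize (∫ z, (∫ ω, diffField lo up κ g ξ r z.1 ω * diffField lo up κ g ξ r z.2 ω ∂P)
      ∂((volume : Measure (EuclideanSpace ℝ (Fin n))).prod volume)) = I
    simp only [div_eq_mul_inv, mul_inv, inv_inv]
    ring
  have hK : ∀ u : EuclideanSpace ℝ (Fin n), ∀ v : EuclideanSpace ℝ (Fin n),
      (Metric.closedBall (0 : EuclideanSpace ℝ (Fin n)) R).indicator (fun _ => C) u *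
      (Metric.closedBall (0 : EuclideanSpace ℝ (Fin n)) R).indicator (fun _ => C) v *
        (C' * ‖u - v‖ ^ (-γ)) ≤ C * C * C' *
      ((Metric.closedBall (0 : EuclideanSpace ℝ (Fin n)) R).indicator (fun _ => (1 : ℝ)) v *
      (Metric.closedBall (0 : EuclideanSpace ℝ (Fin n)) (2 * R)).indicator
        (fun w => ‖w‖ ^ (-γ)) (u - v)) := by
    intro u v
    by_cases hu : u ∈ Metric.closedBall (0 : EuclideanSpace ℝ (Fin n)) R
    · by_cases hv : v ∈ Metric.closedBall (0 : EuclideanSpace ℝ (Fin n)) R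
      · have huv : u - v ∈ Metric.closedBall (0 : EuclideanSpace ℝ (Fin n)) (2 * R) := by
          rw [mem_closedBall_zero_iff] at hu hv ⊢
          linarith [norm_sub_le u v]
        rw [indicator_of_mem hu, indicator_of_mem hv, indicator_of_mem hv, indicator_of_mem huv]
        linarith
      · rw [indicator_of_notMem hv, indicator_of_notMem hv]; simp
    · rw [indicator_of_notMem hu, zero_mul, zero_mul]
      have h1 : 0 ≤ (Metric.closedBall (0 : EuclideanSpace ℝ (Fin n)) R).indicator
        (fun _ => (1 : ℝ)) v := indicator_nonneg (fun _ _ => zero_le_one) _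
      have h2 : 0 ≤ (Metric.closedBall (0 : EuclideanSpace ℝ (Fin n)) (2 * R)).indicator
        (fun w => ‖w‖ ^ (-γ)) (u - v) :=
        indicator_nonneg (fun _ _ => Real.rpow_nonneg (norm_nonneg _) _) _
      positivity
  have htermb : ∀ᶠ r : ℝ in atTop, ∀ s t, ∀ z : EuclideanSpace ℝ (Fin n) ×
      EuclideanSpace ℝ (Fin n), z.1 ≠ z.2 → |term s t r z| ≤ C * C * C' *
      ((Metric.closedBall (0 : EuclideanSpace ℝ (Fin n)) R).indicator (fun _ => (1 : ℝ)) z.2 *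
      (Metric.closedBall (0 : EuclideanSpace ℝ (Fin n)) (2 * R)).indicator
        (fun w => ‖w‖ ^ (-γ)) (z.1 - z.2)) := by
    filter_upwards [hwb, eventually_ge_atTop r₀, eventually_ge_atTop 1] with r hr1 hr2 hr3 s t z hz
    have hr0 : 0 < r := by linarith
    refine le_trans ?_ (hK z.1 z.2)
    have hd : 0 < ‖z.1 - z.2‖ := norm_pos_iff.2 (sub_ne_zero.2 hz)
    have hnn : ∀ x, 0 ≤ (Metric.closedBall (0 : EuclideanSpace ℝ (Fin n)) R).indicator
        (fun _ => C) x := fun x => indicator_nonneg (fun _ _ => hC.le) _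
    have hnorm0 : 0 ≤ r ^ (α * κ) / L r ^ κ :=
      div_nonneg (Real.rpow_nonneg hr0.le _) (pow_nonneg (hspec.slowlyVarying.pos r hr0).le _)
    simp only [hterm]
    rw [abs_mul, abs_mul, abs_mul (B _ ^ κ), abs_pow, abs_of_nonneg hnorm0]
    by_cases hmem : z.1 ∈ Metric.closedBall (0 : EuclideanSpace ℝ (Fin n)) R ∧
        z.2 ∈ Metric.closedBall (0 : EuclideanSpace ℝ (Fin n)) R
    · have hclose := abs_norm_samplePoint_sub_le hr0 s t z.1 z.2
      have hle : ‖samplePoint s (r • z.1) - samplePoint t (r • z.2)‖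
          ≤ (2 * R + 2 * n + 1) * r := by
        have h1 := mem_closedBall_zero_iff.1 hmem.1
        have h2 := mem_closedBall_zero_iff.1 hmem.2
        have h3 : ‖z.1 - z.2‖ ≤ 2 * R := by linarith [norm_sub_le z.1 z.2]
        have h4 := (abs_le.1 hclose).2
        nlinarith [mul_le_mul_of_nonneg_left h3 hr0.le]
      have hk := hkb r hr2 _ _ (norm_nonneg _) hle hd hclose
      exact mul_le_mul (mul_le_mul (hr1 s z.1) (hr1 t z.2) (abs_nonneg _) (hnn _)) hk
        (mul_nonneg (pow_nonneg (abs_nonneg _) _) hnorm0) (mul_nonneg (hnn _) (hnn _))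
    · have hzero : |sampleWeight lo up g s r (r • z.1) / g (r • oneVec n)| *
          |sampleWeight lo up g t r (r • z.2) / g (r • oneVec n)| ≤ 0 := by
        refine (mul_le_mul (hr1 s z.1) (hr1 t z.2) (abs_nonneg _) (hnn _)).trans ?_
        rcases not_and_or.1 hmem with h | h <;> rw [indicator_of_notMem h] <;> simp
      have hzero' := le_antisymm hzero (by positivity)
      rw [hzero', zero_mul]
      exact mul_nonneg (mul_nonneg (hnn _) (hnn _))
        (mul_nonneg hC'.le (Real.rpow_nonneg hd.le _))
  have hmain : Tendsto (fun r => ∫ z, Φ r z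
      ∂((volume : Measure (EuclideanSpace ℝ (Fin n))).prod volume)) atTop
      (𝓝 (∫ _ : EuclideanSpace ℝ (Fin n) × EuclideanSpace ℝ (Fin n), (0 : ℝ)
        ∂(volume.prod volume))) := by
    refine tendsto_integral_filter_of_dominated_convergence
      (fun z => 4 * κ.factorial * (C * C * C' *
      ((Metric.closedBall (0 : EuclideanSpace ℝ (Fin n)) R).indicator (fun _ => (1 : ℝ)) z.2 *
      (Metric.closedBall (0 : EuclideanSpace ℝ (Fin n)) (2 * R)).indicator
        (fun w => ‖w‖ ^ (-γ)) (z.1 - z.2)))) ?_ ?_ ?_ ?_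
    · refine Eventually.of_forall fun r => ?_
      have hm := measurable_diffField (κ := κ) hΔ hg.measurable hξ.measurable r
      have hm1 : Measurable fun p : (EuclideanSpace ℝ (Fin n) × EuclideanSpace ℝ (Fin n)) × Ω =>
          diffField lo up κ g ξ r (r • p.1.1) p.2 :=
        hm.comp (f := fun p : (EuclideanSpace ℝ (Fin n) × EuclideanSpace ℝ (Fin n)) × Ω =>
          (r • p.1.1, p.2)) (by fun_prop)
      have hm2 : Measurable fun p : (EuclideanSpace ℝ (Fin n) × EuclideanSpace ℝ (Fin n)) × Ω =>
          diffField lo up κ g ξ r (r • p.1.2) p.2 :=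
        hm.comp (f := fun p : (EuclideanSpace ℝ (Fin n) × EuclideanSpace ℝ (Fin n)) × Ω =>
          (r • p.1.2, p.2)) (by fun_prop)
      exact ((hm1.mul hm2).stronglyMeasurable.integral_prod_right'
        (ν := P)).aestronglyMeasurable.const_mul _
    · filter_upwards [htermb] with r hr
      filter_upwards [ae_fst_ne_snd hn1] with z hz
      rw [hΦterm, Real.norm_eq_abs, abs_mul, Nat.abs_cast]
      simp only [Fintype.sum_bool, sampleSign, if_true, Bool.false_eq_true, if_false]
      have b1 := hr true true z hz
      have b2 := hr true false z hz
      have b3 := hr false true z hz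
      have b4 := hr false false z hz
      rw [mul_comm (4 : ℝ), mul_assoc (κ.factorial : ℝ)]
      refine mul_le_mul_of_nonneg_left ?_ (Nat.cast_nonneg (α := ℝ) _)
      rw [abs_le] at b1 b2 b3 b4 ⊢
      constructor <;> linarith [b1.1, b1.2, b2.1, b2.2, b3.1, b3.2, b4.1, b4.2]
    · exact ((integrable_indicator_mul_norm_sub_rpow hn1 hγ2 R).const_mul _).const_mul _
    · have hae1 := Measure.quasiMeasurePreserving_fst
        (μ := (volume : Measure (EuclideanSpace ℝ (Fin n))))
        (ν := (volume : Measure (EuclideanSpace ℝ (Fin n)))) |>.ae hwlim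
      have hae2 := Measure.quasiMeasurePreserving_snd
        (μ := (volume : Measure (EuclideanSpace ℝ (Fin n))))
        (ν := (volume : Measure (EuclideanSpace ℝ (Fin n)))) |>.ae hwlim
      filter_upwards [hae1, hae2, ae_fst_ne_snd hn1] with z hz1 hz2 hz
      have hd : 0 < ‖z.1 - z.2‖ := norm_pos_iff.2 (sub_ne_zero.2 hz)
      set l := (window lo up n).indicator G z.1 * (window lo up n).indicator G z.2 *
        ‖z.1 - z.2‖ ^ (-(α * κ)) with hl
      have hlim : ∀ s t, Tendsto (fun r => term s t r z) atTop (𝓝 l) := fun s t =>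
        ((hz1 s).mul (hz2 t)).mul (hcov.tendsto_normalized hspec.slowlyVarying hspec.equiv κ hd
          (tendsto_norm_samplePoint_sub s t z.1 z.2))
      simp_rw [hΦterm]
      have hsum : Tendsto (fun r => (κ.factorial : ℝ) *
          ∑ s, ∑ t, sampleSign s * sampleSign t * term s t r z) atTop
          (𝓝 (κ.factorial * ∑ s, ∑ t, sampleSign s * sampleSign t * l)) :=
        (tendsto_finsetSum _ fun s _ => tendsto_finsetSum _ fun t _ =>
          (hlim s t).const_mul _).const_mul _
      -- The common limit is multiplied by the square of the sum of the signs, `(1 - 1)² = 0`.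
      convert! hsum using 2
      simp [sampleSign]
  rw [integral_zero] at hmain
  exact hmain.congr' hratio

end
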